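/- Let $K\ge 2$ and consider a $K$-armed bandit in which all arms have the same reward distribution $\nu$ on $\mathbb{R}$, where $\nu$ has mean $\mu$, positive variance, and is $1$-sub-Gaussian: $\mathbb{E}_{X\sim\nu}[e^{\lambda(X-\mu)}]\le e^{\lambda^2/2}$ for all $\lambda\in\mathbb{R}$. In round $t$ the learner pulls an arm $A_t\in\{1,\dots,K\}$ and receives $X_t=\mu+\epsilon_{A_t,t}$, where for every arm $a$ the variable $\mu+\epsilon_{a,t}$ has law $\nu$ and $\epsilon_{a,t}$ is independent of the history $A_1,X_1,\dots,A_{t-1},X_{t-1}$ and of $A_t$. Let $n_{a,t}$ be the number of pulls of arm $a$ in rounds $1,\dots,t$ and $\widehat\mu_a(t)$ the empirical mean of the rewards received from it. An index algorithm with index $U_a(t)$ and horizon $T$ first pulls every arm once and then, for $K\le t<T$, chooses $A_{t+1}\in\arg\max_a U_a(t)$, with ties broken in an arbitrary way. Consider the indices - MOSS: $U_a(t)=\widehat\mu_a(t)+\sqrt{\dfrac{\max\{0,\log(T/(K n_{a,t}))\}}{n_{a,t}}}$; - Anytime-MOSS: $U_a(t)=\widehat\mu_a(t)+\sqrt{\dfrac{\max\{0,\log(t/(K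 n_{a,t}))\}}{n_{a,t}}}$; - Vanilla-MOSS: $U_a(t)=\widehat\mu_a(t)+\sqrt{\dfrac{\log(T/n_{a,t})}{n_{a,t}}}$; - OC-UCB with a parameter $\eta>0$: $U_a(t)=\widehat\mu_a(t)+\sqrt{\dfrac{2(1+\eta)}{n_{a,t}}\log(T/t)}$; - ADA-UCB: $U_a(t)=\widehat\mu_a(t)+\sqrt{\dfrac{2}{n_{a,t}}\max\{0,\log(T/H_a)\}}$ with $H_a=\sum_{j=1}^K\min\{n_{a,t},\sqrt{n_{a,t}n_{j,t}}\}$. Each of these five algorithms is unstable. That is, if for every $T$ the algorithm is run with horizon $T$, and $n_{a,T}$ denotes the number of pulls of arm $a$ in the $T$ rounds of that run, then it is not the case that for every arm $a$ there are non-random scalars $n^*_{a,T}$ with $n^*_{a,T}\to\infty$ and $n_{a,T}/n^*_{a,T}\to 1$ in probability as $T\to\infty$. -/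

import Mathlib

open MeasureTheory ProbabilityTheory Filter

universe u

namespace Bandit

noncomputable section

/-! ### Pull counts, empirical means, history

Rounds are numbered `1, 2, 3, …`; `A t` is the arm chosen and `X t` the reward received in
round `t`. -/

/-- The number `n_{a,t}` of pulls of arm `a` in the rounds `1, …, t`. -/
def pulls {Ω : Type*} {K : ℕ} (A : ℕ → Ω → Fin K) (a : Fin K) (t : ℕ) (ω : Ω) : ℕ :=
  ((Finset.Icc 1 t).filter (fun s => A s ω = a)).card

/-- The empirical mean of the rewards received from arm `a` in the rounds `1, …, t`. -/
def empMean {Ω : Type*} {K : ℕ} (A : ℕ → Ω → Fin K) (X : ℕ → Ω → ℝ)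
    (a : Fin K) (t : ℕ) (ω : Ω) : ℝ :=
  (∑ s ∈ (Finset.Icc 1 t).filter (fun s => A s ω = a), X s ω) / (pulls A a t ω : ℝ)

/-- The history `σ(A_1, X_1, …, A_t, X_t)`. -/
abbrev history {Ω : Type*} {K : ℕ} (A : ℕ → Ω → Fin K) (X : ℕ → Ω → ℝ) (t : ℕ) :
    MeasurableSpace Ω :=
  ⨆ s ∈ Finset.Icc 1 t,
    (MeasurableSpace.comap (A s) inferInstance ⊔ MeasurableSpace.comap (X s) inferInstance)

/-! ### The bandit model -/

/-- `A`, `X` are the actions and rewards of `T` rounds of interaction with the `K`-armed bandit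
whose arm `a` has reward distribution `ν a`, with mean `∫ x, x ∂(ν a)`. Pulling arm `a` in round `t`
gives its mean plus a noise `ε a t`, and the noise of round `t` is independent of
the history of the earlier rounds together with the action of round `t`. (If the action is a function
of the history this is independence of the history; the form chosen also lets the learner
randomize.) -/
structure IsInteraction {Ω : Type*} [MeasurableSpace Ω] {K : ℕ} (P : Measure Ω)
    (ν : Fin K → Measure ℝ) (T : ℕ) (ε : Fin K → ℕ → Ω → ℝ)
    (A : ℕ → Ω → Fin K) (X : ℕ → Ω → ℝ) : Prop where
  measurable_action : ∀ t ∈ Finset.Icc 1 T, Measurable (A t)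
  measurable_noise : ∀ t ∈ Finset.Icc 1 T, ∀ a, Measurable (ε a t)
  reward_eq : ∀ t ∈ Finset.Icc 1 T, ∀ ω, X t ω = (∫ x, x ∂(ν (A t ω))) + ε (A t ω) t ω
  reward_law : ∀ t ∈ Finset.Icc 1 T, ∀ a, P.map (fun ω => (∫ x, x ∂(ν a)) + ε a t ω) = ν a
  noise_indep : ∀ t ∈ Finset.Icc 1 T, ∀ a,
    Indep (MeasurableSpace.comap (ε a t) inferInstance)
      (history A X (t - 1) ⊔ MeasurableSpace.comap (A t) inferInstance) P

/-! ### Index algorithms -/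

/-- An upper confidence bound `U_a(t)`, as a function of the horizon `T`, the time `t`, the pull
counts `n` and the empirical means `m` of all arms at time `t`, and the arm `a`. -/
abbrev Index (K : ℕ) : Type := ℕ → ℕ → (Fin K → ℕ) → (Fin K → ℝ) → Fin K → ℝ

/-- The value `U_a(t)` of an index along a sequence of actions and rewards. -/
def indexAt {Ω : Type*} {K : ℕ} (U : Index K) (T : ℕ) (A : ℕ → Ω → Fin K) (X : ℕ → Ω → ℝ)
    (a : Fin K) (t : ℕ) (ω : Ω) : ℝ :=
  U T t (fun b => pulls A b t ω) (fun b => empMean A X b t ω) a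

/-- With horizon `T`, the learner first pulls each arm once (in any order) and then, in each round
`t + 1 ≤ T`, an arm that maximizes `U_a(t)`; ties are broken in any way. -/
structure FollowsIndex {Ω : Type*} {K : ℕ} (U : Index K) (T : ℕ)
    (A : ℕ → Ω → Fin K) (X : ℕ → Ω → ℝ) : Prop where
  init : K ≤ T → ∀ ω a, pulls A a K ω = 1
  optimism : ∀ t, K ≤ t → t < T → ∀ ω a,
    indexAt U T A X a t ω ≤ indexAt U T A X (A (t + 1) ω) t ω

/-- MOSS. -/
def moss (K : ℕ) : Index K := fun T _ n m a =>
  m a + √(max 0 (Real.log ((T : ℝ) / ((K : ℝ) * (n a : ℝ)))) / (n a : ℝ))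

/-- Anytime-MOSS. -/
def anytimeMoss (K : ℕ) : Index K := fun _ t n m a =>
  m a + √(max 0 (Real.log ((t : ℝ) / ((K : ℝ) * (n a : ℝ)))) / (n a : ℝ))

/-- Vanilla-MOSS. -/
def vanillaMoss (K : ℕ) : Index K := fun T _ n m a =>
  m a + √(Real.log ((T : ℝ) / (n a : ℝ)) / (n a : ℝ))

/-- OC-UCB with parameter `η`. -/
def ocUcb (K : ℕ) (η : ℝ) : Index K := fun T t n m a =>
  m a + √(2 * (1 + η) / (n a : ℝ) * Real.log ((T : ℝ) / (t : ℝ)))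

/-- The quantity `H_a = ∑_j min(n_a, √(n_a n_j))` of ADA-UCB. -/
def adaH {K : ℕ} (n : Fin K → ℕ) (a : Fin K) : ℝ :=
  ∑ j : Fin K, min (n a : ℝ) (√((n a : ℝ) * (n j : ℝ)))

/-- ADA-UCB. If `H_a > T` the logarithm is negative and the exploration bonus is `0`. -/
def adaUcb (K : ℕ) : Index K := fun T _ n m a =>
  m a + √(2 / (n a : ℝ) * max 0 (Real.log ((T : ℝ) / adaH n a)))

/-! ### Stability -/

/-- Stability of a bandit algorithm; `A T t` is the action in round `t` when the algorithm is
run with horizon `T`. For every arm there are non-random `n*_{a,T} → ∞` such that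
`n_{a,T} / n*_{a,T} → 1` in probability. -/
def IsStable {Ω : Type*} [MeasurableSpace Ω] {K : ℕ} (P : Measure Ω)
    (A : ℕ → ℕ → Ω → Fin K) : Prop :=
  ∀ a : Fin K, ∃ nstar : ℕ → ℝ,
    TendstoInMeasure P (fun (T : ℕ) (ω : Ω) => (pulls (A T) a T ω : ℝ) / nstar T) atTop
      (fun _ => (1 : ℝ)) ∧
    Tendsto nstar atTop atTop

/-- The algorithm with index `U` is unstable on the bandit with reward distributions `ν`:
whatever the underlying probability space and the way ties are broken, its runs with horizons
`T = 0, 1, 2, …` are not stable. -/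
def IsUnstable {K : ℕ} (ν : Fin K → Measure ℝ) (U : Index K) : Prop :=
  ∀ (Ω : Type u) [MeasurableSpace Ω] (P : Measure Ω) [IsProbabilityMeasure P]
    (ε : ℕ → Fin K → ℕ → Ω → ℝ) (A : ℕ → ℕ → Ω → Fin K) (X : ℕ → ℕ → Ω → ℝ),
    (∀ T, IsInteraction P ν T (ε T) (A T) (X T)) →
    (∀ T, FollowsIndex U T (A T) (X T)) →
    ¬ IsStable P A

end

end Bandit

/-! With identical arms, every arm has a chance of at least some `q > 0`, independent of `T`, to
receive 90% of the pulls. This contradicts stability: `n_{a,T}` would be near `n*_{a,T}` both on an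
event where arm `a` takes 90% of the rounds and on one where another arm does.

The bound `q` comes from a contiguity argument (`exists_pos_le_measure_pulls`). Tilt the reward law
of arm `a` so that its mean rises by `Δ` of order `1/√T`. The likelihood ratio of `T` rounds then
has second moment at most `(1 + θ²)^T` with `θ² T` fixed, so an event with probability at least 1/2
under the tilted model keeps a probability bounded below under the original one
(`le_measure_of_withDensity`).

In the tilted model, `exists_measure_pulls_lt_le_half` shows that arm `a` takes most rounds once `Δ²
T` is a large constant. An arm pulled a positive fraction of the time has a bonus of order only
`1/√T` (`HasLogBonus`), so its index stays within `Δ/2` of its mean. The index of `a` stays above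
its mean minus `Δ/2`, by concentration if `a` has many pulls and by `IsPersistent` if it has few.
Hence no other arm can accumulate many pulls.

Persistence rests on a peeling bound without a log-log loss,
`measure_exists_sqrt_log_le_abs_deviation`: uniformly in `T`, deviations over at most `ε T` pulls
stay below `√(n log(c'T/n))` with probability tending to 1 as `ε → 0`. For OC-UCB, whose bonus
involves `log(T/t)`, an induction over time (`ocUcb_pulls_ge`) is needed instead. -/

namespace Bandit

open scoped ENNReal

/-! ### Adaptive sampling -/

section

variable {Ω : Type*} {K : ℕ} {A : ℕ → Ω → Fin K} {X : ℕ → Ω → ℝ}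

/-- What is known to the learner when the reward of round `t + 1` is drawn. -/
abbrev preReward (A : ℕ → Ω → Fin K) (X : ℕ → Ω → ℝ) (t : ℕ) : MeasurableSpace Ω :=
  history A X t ⊔ MeasurableSpace.comap (A (t + 1)) inferInstance

theorem history_mono {s t : ℕ} (h : s ≤ t) : history A X s ≤ history A X t :=
  biSup_mono fun _ hi => Finset.Icc_subset_Icc_right h hi

theorem measurable_action_history (t : ℕ) : Measurable[history A X (t + 1)] (A (t + 1)) :=
  Measurable.mono (comap_measurable _)
    (le_sup_left.trans (le_biSup (fun s => MeasurableSpace.comap (A s) inferInstance ⊔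
      MeasurableSpace.comap (X s) inferInstance) (by simp))) le_rfl

theorem measurable_reward_history (t : ℕ) : Measurable[history A X (t + 1)] (X (t + 1)) :=
  Measurable.mono (comap_measurable _)
    (le_sup_right.trans (le_biSup (fun s => MeasurableSpace.comap (A s) inferInstance ⊔
      MeasurableSpace.comap (X s) inferInstance) (by simp))) le_rfl

theorem measurable_action_preReward (t : ℕ) : Measurable[preReward A X t] (A (t + 1)) :=
  Measurable.mono (comap_measurable _) le_sup_right le_rfl

theorem preReward_le_history (t : ℕ) : preReward A X t ≤ history A X (t + 1) :=
  sup_le (history_mono t.le_succ) (measurable_action_history t).comap_le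

/-- The likelihood ratio of the first `t` rounds. -/
noncomputable def likelihood (G : Fin K → ℝ → ℝ≥0∞) (A : ℕ → Ω → Fin K) (X : ℕ → Ω → ℝ) :
    ℕ → Ω → ℝ≥0∞
  | 0, _ => 1
  | t + 1, ω => likelihood G A X t ω * G (A (t + 1) ω) (X (t + 1) ω)

theorem measurable_apply_pair {m : MeasurableSpace Ω} {G : Fin K → ℝ → ℝ≥0∞}
    (hG : ∀ a, Measurable (G a)) {f : Ω → Fin K} {g : Ω → ℝ} (hf : Measurable[m] f)
    (hg : Measurable[m] g) : Measurable[m] (fun ω => G (f ω) (g ω)) := by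
  have h1 : Measurable (fun p : Fin K × ℝ => G p.1 p.2) :=
    measurable_from_prod_countable_right hG
  exact h1.comp (hf.prodMk hg)

theorem measurable_likelihood {G : Fin K → ℝ → ℝ≥0∞} (hG : ∀ a, Measurable (G a)) (t : ℕ) :
    Measurable[history A X t] (likelihood G A X t) := by
  induction t with
  | zero => exact measurable_const
  | succ t ih =>
    exact (ih.mono (history_mono t.le_succ) le_rfl).mul
      (measurable_apply_pair hG (measurable_action_history t) (measurable_reward_history t))

/-- The likelihood process, frozen as soon as it reaches the level `c`. -/
noncomputable def frozenLikelihood (G : Fin K → ℝ → ℝ≥0∞) (c : ℝ≥0∞) (A : ℕ → Ω → Fin K)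
    (X : ℕ → Ω → ℝ) : ℕ → Ω → ℝ≥0∞
  | 0, _ => 1
  | t + 1, ω => frozenLikelihood G c A X t ω *
      (if c ≤ frozenLikelihood G c A X t ω then 1 else G (A (t + 1) ω) (X (t + 1) ω))

theorem measurable_frozenLikelihood {G : Fin K → ℝ → ℝ≥0∞} (hG : ∀ a, Measurable (G a))
    (c : ℝ≥0∞) (t : ℕ) : Measurable[history A X t] (frozenLikelihood G c A X t) := by
  induction t with
  | zero => exact measurable_const
  | succ t ih =>
    have ih' : Measurable[history A X (t + 1)] (frozenLikelihood G c A X t) :=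
      ih.mono (history_mono t.le_succ) le_rfl
    refine ih'.mul (Measurable.ite ?_ measurable_const ?_)
    · exact ih' measurableSet_Ici
    · exact measurable_apply_pair hG (measurable_action_history t) (measurable_reward_history t)

/-- Freezing turns "the level is reached at some time" into a statement about the terminal value
alone, so that Ville's inequality reduces to Markov's. -/
theorem frozenLikelihood_eq_or (G : Fin K → ℝ → ℝ≥0∞) (c : ℝ≥0∞) (t : ℕ) (ω : Ω) :
    c ≤ frozenLikelihood G c A X t ω ∨
      (frozenLikelihood G c A X t ω = likelihood G A X t ω ∧
        ∀ s ≤ t, likelihood G A X s ω < c) := by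
  induction t with
  | zero =>
    by_cases h : c ≤ 1
    · exact Or.inl (by simpa [frozenLikelihood] using h)
    · refine Or.inr ⟨rfl, fun s hs => ?_⟩
      obtain rfl : s = 0 := by omega
      simpa [likelihood] using h
  | succ t ih =>
    by_cases h : c ≤ frozenLikelihood G c A X t ω
    · left; simp [frozenLikelihood, h]
    · obtain ⟨h1, h2⟩ := ih.resolve_left h
      have h3 : frozenLikelihood G c A X (t + 1) ω = likelihood G A X (t + 1) ω := by
        simp [frozenLikelihood, likelihood, h, ← h1]
      by_cases h4 : c ≤ frozenLikelihood G c A X (t + 1) ω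
      · exact Or.inl h4
      · refine Or.inr ⟨h3, fun s hs => ?_⟩
        rcases Nat.lt_or_ge t s with h5 | h5
        · obtain rfl : s = t + 1 := by omega
          rw [← h3]; exact not_le.mp h4
        · exact h2 s h5

variable [MeasurableSpace Ω] {P : Measure Ω} {ν : Fin K → Measure ℝ} {T : ℕ}

/-- Given the past and the action `a` of a round, the reward of the round has law `ν a`. -/
structure IsAdaptive (P : Measure Ω) (ν : Fin K → Measure ℝ) (T : ℕ)
    (A : ℕ → Ω → Fin K) (X : ℕ → Ω → ℝ) : Prop where
  measurable_action : ∀ t ∈ Finset.Icc 1 T, Measurable (A t)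
  measurable_reward : ∀ t ∈ Finset.Icc 1 T, Measurable (X t)
  setLIntegral_mul : ∀ t < T, ∀ a, ∀ Z : Ω → ℝ≥0∞, Measurable[preReward A X t] Z →
    ∀ φ : ℝ → ℝ≥0∞, Measurable φ →
      ∫⁻ ω in A (t + 1) ⁻¹' {a}, Z ω * φ (X (t + 1) ω) ∂P =
        (∫⁻ ω in A (t + 1) ⁻¹' {a}, Z ω ∂P) * ∫⁻ x, φ x ∂(ν a)

namespace IsAdaptive

theorem history_le (h : IsAdaptive P ν T A X) {t : ℕ} (ht : t ≤ T) :
    history A X t ≤ ‹MeasurableSpace Ω› := by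
  refine iSup₂_le fun s hs => sup_le ?_ ?_
  · exact (h.measurable_action s (Finset.Icc_subset_Icc_right ht hs)).comap_le
  · exact (h.measurable_reward s (Finset.Icc_subset_Icc_right ht hs)).comap_le

theorem measurable_action_succ (h : IsAdaptive P ν T A X) {t : ℕ} (ht : t < T) :
    Measurable (A (t + 1)) :=
  h.measurable_action _ (by simp; omega)

theorem lintegral_eq_sum (h : IsAdaptive P ν T A X) {t : ℕ} (ht : t < T) (f : Ω → ℝ≥0∞) :
    ∫⁻ ω, f ω ∂P = ∑ a, ∫⁻ ω in A (t + 1) ⁻¹' {a}, f ω ∂P := by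
  have hm := h.measurable_action_succ ht
  rw [← lintegral_biUnion_finset (s := Finset.univ) (t := fun a => A (t + 1) ⁻¹' {a})]
  · simp [← Set.preimage_iUnion, Set.iUnion_of_singleton]
  · intro a _ b _ hab
    exact Disjoint.preimage _ (by simpa using hab)
  · exact fun a _ => hm (measurableSet_singleton a)

theorem lintegral_mul (h : IsAdaptive P ν T A X) {t : ℕ} (ht : t < T) {Z : Ω → ℝ≥0∞}
    (hZ : Measurable[preReward A X t] Z) {φ : Fin K → ℝ → ℝ≥0∞} (hφ : ∀ a, Measurable (φ a)) :
    ∫⁻ ω, Z ω * φ (A (t + 1) ω) (X (t + 1) ω) ∂P =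
      ∑ a, (∫⁻ ω in A (t + 1) ⁻¹' {a}, Z ω ∂P) * ∫⁻ x, φ a x ∂(ν a) := by
  rw [h.lintegral_eq_sum ht]
  refine Finset.sum_congr rfl fun a _ => ?_
  rw [← h.setLIntegral_mul t ht a Z hZ (φ a) (hφ a)]
  refine setLIntegral_congr_fun (h.measurable_action_succ ht (measurableSet_singleton a)) ?_
  intro ω hω
  have : A (t + 1) ω = a := hω
  simp [this]

theorem lintegral_mul_le (h : IsAdaptive P ν T A X) {t : ℕ} (ht : t < T) {Z : Ω → ℝ≥0∞}
    (hZ : Measurable[preReward A X t] Z) {φ : Fin K → ℝ → ℝ≥0∞} (hφ : ∀ a, Measurable (φ a))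
    (hφ1 : ∀ a, ∫⁻ x, φ a x ∂(ν a) ≤ 1) :
    ∫⁻ ω, Z ω * φ (A (t + 1) ω) (X (t + 1) ω) ∂P ≤ ∫⁻ ω, Z ω ∂P := by
  rw [h.lintegral_mul ht hZ hφ, h.lintegral_eq_sum ht]
  exact Finset.sum_le_sum fun a _ => mul_le_of_le_one_right' (hφ1 a)

theorem lintegral_mul_eq (h : IsAdaptive P ν T A X) {t : ℕ} (ht : t < T) {Z : Ω → ℝ≥0∞}
    (hZ : Measurable[preReward A X t] Z) {φ : Fin K → ℝ → ℝ≥0∞} (hφ : ∀ a, Measurable (φ a))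
    (hφ1 : ∀ a, ∫⁻ x, φ a x ∂(ν a) = 1) :
    ∫⁻ ω, Z ω * φ (A (t + 1) ω) (X (t + 1) ω) ∂P = ∫⁻ ω, Z ω ∂P := by
  rw [h.lintegral_mul ht hZ hφ, h.lintegral_eq_sum ht]
  simp [hφ1]

end IsAdaptive

/-- On the event that `a` is chosen the reward is a function of the noise of `a`, which is
independent of the past and the action. The noise variables disappear here: only the conditional
reward law survives a change of measure. -/
theorem IsInteraction.isAdaptive [IsProbabilityMeasure P] {ε : Fin K → ℕ → Ω → ℝ}
    (h : IsInteraction P ν T ε A X) : IsAdaptive P ν T A X := by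
  have hX : ∀ t ∈ Finset.Icc 1 T, Measurable (X t) := by
    intro t ht
    have h1 : Measurable (fun p : Fin K × Ω => (∫ x, x ∂(ν p.1)) + ε p.1 t p.2) :=
      measurable_from_prod_countable_right fun a =>
        (h.measurable_noise t ht a).const_add (∫ x, x ∂(ν a))
    have h2 : X t = fun ω => (∫ x, x ∂(ν (A t ω))) + ε (A t ω) t ω := funext (h.reward_eq t ht)
    rw [h2]
    exact h1.comp ((h.measurable_action t ht).prodMk measurable_id)
  have hH : ∀ t ≤ T, history A X t ≤ ‹MeasurableSpace Ω› := fun t ht => by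
    refine iSup₂_le fun s hs => sup_le ?_ ?_
    · exact (h.measurable_action s (Finset.Icc_subset_Icc_right ht hs)).comap_le
    · exact (hX s (Finset.Icc_subset_Icc_right ht hs)).comap_le
  refine ⟨h.measurable_action, hX, fun t ht a Z hZ φ hφ => ?_⟩
  have hmem : t + 1 ∈ Finset.Icc 1 T := by simp; omega
  have hA := h.measurable_action _ hmem
  have hS : MeasurableSet (A (t + 1) ⁻¹' {a}) := hA (measurableSet_singleton a)
  have hS' : MeasurableSet[preReward A X t] (A (t + 1) ⁻¹' {a}) :=
    measurable_action_preReward t (measurableSet_singleton a)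
  set g : Ω → ℝ := fun ω => (∫ x, x ∂(ν a)) + ε a (t + 1) ω with hg
  have hgm : Measurable g := (h.measurable_noise _ hmem a).const_add _
  have hgc : Measurable[MeasurableSpace.comap (ε a (t + 1)) inferInstance] g :=
    Measurable.const_add (comap_measurable _) _
  have e1 : ∫⁻ ω in A (t + 1) ⁻¹' {a}, Z ω * φ (X (t + 1) ω) ∂P =
      ∫⁻ ω, (A (t + 1) ⁻¹' {a}).indicator Z ω * φ (g ω) ∂P := by
    rw [← lintegral_indicator hS]
    refine lintegral_congr fun ω => ?_
    by_cases hω : ω ∈ A (t + 1) ⁻¹' {a}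
    · have hω' : A (t + 1) ω = a := hω
      simp [h.reward_eq _ hmem ω, hω', hg]
    · simp [Set.indicator_of_notMem hω]
  have e2 := lintegral_mul_eq_lintegral_mul_lintegral_of_independent_measurableSpace
    (μ := P) (sup_le (hH t ht.le) hA.comap_le) (h.measurable_noise _ hmem a).comap_le
    (h.noise_indep _ hmem a).symm (hZ.indicator hS') (hφ.comp hgc)
  simp only [Function.comp_apply] at e2
  rw [e1, e2, lintegral_indicator hS, ← h.reward_law _ hmem a, lintegral_map hφ hgm]

/-! ### Change of measure by the likelihood ratio -/

namespace IsAdaptive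

/-- Martingale property: each factor after round `t` has conditional mean one and integrates out. -/
theorem lintegral_mul_likelihood (h : IsAdaptive P ν T A X) {G : Fin K → ℝ → ℝ≥0∞}
    (hG : ∀ a, Measurable (G a)) (hG1 : ∀ a, ∫⁻ x, G a x ∂(ν a) = 1) {t : ℕ} (ht : t ≤ T)
    {Z : Ω → ℝ≥0∞} (hZ : Measurable[history A X t] Z) :
    ∫⁻ ω, Z ω * likelihood G A X T ω ∂P = ∫⁻ ω, Z ω * likelihood G A X t ω ∂P := by
  induction T, ht using Nat.le_induction with
  | base => rfl
  | succ n hn ih =>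
    have h' : IsAdaptive P ν n A X :=
      ⟨fun t ht => h.measurable_action t (Finset.Icc_subset_Icc_right n.le_succ ht),
        fun t ht => h.measurable_reward t (Finset.Icc_subset_Icc_right n.le_succ ht),
        fun t ht => h.setLIntegral_mul t (ht.trans n.lt_succ_self)⟩
    rw [← ih h']
    simp only [likelihood, ← mul_assoc]
    refine h.lintegral_mul_eq n.lt_succ_self (Z := fun ω => Z ω * likelihood G A X n ω) ?_ hG hG1
    exact ((hZ.mono (history_mono hn) le_rfl).mul (measurable_likelihood hG n)).mono
      le_sup_left le_rfl

theorem withDensity (h : IsAdaptive P ν T A X) {G : Fin K → ℝ → ℝ≥0∞}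
    (hG : ∀ a, Measurable (G a)) (hG1 : ∀ a, ∫⁻ x, G a x ∂(ν a) = 1) :
    IsAdaptive (P.withDensity (likelihood G A X T)) (fun a => (ν a).withDensity (G a)) T A X := by
  have hLm : Measurable (likelihood G A X T) :=
    (measurable_likelihood hG T).mono (h.history_le le_rfl) le_rfl
  have key : ∀ t ≤ T, ∀ Z : Ω → ℝ≥0∞, Measurable[history A X t] Z →
      ∫⁻ ω, Z ω ∂(P.withDensity (likelihood G A X T)) =
        ∫⁻ ω, Z ω * likelihood G A X t ω ∂P := by
    intro t ht Z hZ
    rw [lintegral_withDensity_eq_lintegral_mul _ hLm (hZ.mono (h.history_le ht) le_rfl),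
      ← h.lintegral_mul_likelihood hG hG1 ht hZ]
    simp [mul_comm]
  refine ⟨h.measurable_action, h.measurable_reward, fun t ht a Z hZ φ hφ => ?_⟩
  have hS := h.measurable_action_succ ht (measurableSet_singleton a)
  have hS' : MeasurableSet[preReward A X t] (A (t + 1) ⁻¹' {a}) :=
    measurable_action_preReward t (measurableSet_singleton a)
  have hL : Measurable[preReward A X t] (likelihood G A X t) :=
    (measurable_likelihood hG t).mono le_sup_left le_rfl
  have step : ∀ ψ : ℝ → ℝ≥0∞, Measurable ψ →
      ∫⁻ ω in A (t + 1) ⁻¹' {a}, Z ω * ψ (X (t + 1) ω) ∂(P.withDensity (likelihood G A X T)) =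
        (∫⁻ ω in A (t + 1) ⁻¹' {a}, Z ω * likelihood G A X t ω ∂P) *
          ∫⁻ x, ψ x ∂((ν a).withDensity (G a)) := by
    intro ψ hψ
    rw [← lintegral_indicator hS, key (t + 1) ht, lintegral_withDensity_eq_lintegral_mul _ (hG a) hψ]
    · have := h.setLIntegral_mul t ht a _ (hZ.mul hL) _ ((hG a).mul hψ)
      simp only [Pi.mul_apply] at this ⊢
      rw [← this, ← lintegral_indicator hS]
      refine lintegral_congr fun ω => ?_
      by_cases hω : ω ∈ A (t + 1) ⁻¹' {a}
      · have hω' : A (t + 1) ω = a := hω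
        simp only [Set.indicator_of_mem hω, likelihood, hω']
        ring
      · simp [Set.indicator_of_notMem hω]
    · refine Measurable.indicator ?_ (preReward_le_history t _ hS')
      exact (hZ.mono (preReward_le_history t) le_rfl).mul
        (hψ.comp (measurable_reward_history t))
  -- The case `ψ = 1` identifies the first factor in `step` as the integral of `Z` under the changed
  -- measure.
  have h1 := step 1 measurable_const
  have h2 : ∫⁻ x, (1 : ℝ → ℝ≥0∞) x ∂((ν a).withDensity (G a)) = 1 := by
    simp [withDensity_apply, hG1]
  rw [h2, mul_one] at h1
  rw [step φ hφ, ← h1]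
  simp

theorem isProbabilityMeasure_withDensity [IsProbabilityMeasure P] (h : IsAdaptive P ν T A X)
    {G : Fin K → ℝ → ℝ≥0∞} (hG : ∀ a, Measurable (G a)) (hG1 : ∀ a, ∫⁻ x, G a x ∂(ν a) = 1) :
    IsProbabilityMeasure (P.withDensity (likelihood G A X T)) := by
  constructor
  have := h.lintegral_mul_likelihood hG hG1 (Nat.zero_le T) (Z := 1) measurable_const
  simpa [likelihood] using this

/-- Whichever arm is chosen, a round multiplies the conditional second moment by at most `r`; the
common bound makes the random pull counts irrelevant. -/
theorem lintegral_likelihood_sq_le [IsProbabilityMeasure P] (h : IsAdaptive P ν T A X)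
    {G : Fin K → ℝ → ℝ≥0∞} (hG : ∀ a, Measurable (G a)) {r : ℝ≥0∞} (hr0 : r ≠ 0) (hr : r ≠ ∞)
    (hG2 : ∀ a, ∫⁻ x, G a x ^ 2 ∂(ν a) ≤ r) {t : ℕ} (ht : t ≤ T) :
    ∫⁻ ω, likelihood G A X t ω ^ 2 ∂P ≤ r ^ t := by
  induction t with
  | zero => simp [likelihood]
  | succ t ih =>
    have h1 := h.lintegral_mul_le (t := t) ht (Z := fun ω => r * likelihood G A X t ω ^ 2)
      (((measurable_likelihood hG t).pow_const 2).const_mul r |>.mono le_sup_left le_rfl)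
      (φ := fun a x => r⁻¹ * G a x ^ 2) (fun a => ((hG a).pow_const 2).const_mul _) (fun a => by
        rw [lintegral_const_mul _ ((hG a).pow_const 2)]
        calc r⁻¹ * ∫⁻ x, G a x ^ 2 ∂(ν a) ≤ r⁻¹ * r := by gcongr; exact hG2 a
          _ = 1 := ENNReal.inv_mul_cancel hr0 hr)
    have hm : Measurable (fun ω => likelihood G A X t ω ^ 2) :=
      (((measurable_likelihood hG t).pow_const 2)).mono (h.history_le (by omega)) le_rfl
    rw [lintegral_const_mul _ hm] at h1
    calc ∫⁻ ω, likelihood G A X (t + 1) ω ^ 2 ∂P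
        = ∫⁻ ω, r * likelihood G A X t ω ^ 2 *
            (r⁻¹ * G (A (t + 1) ω) (X (t + 1) ω) ^ 2) ∂P := by
          refine lintegral_congr fun ω => ?_
          rw [likelihood, mul_pow]
          calc _ = (r * r⁻¹) * (likelihood G A X t ω ^ 2 *
                G (A (t + 1) ω) (X (t + 1) ω) ^ 2) := by
                rw [ENNReal.mul_inv_cancel hr0 hr, one_mul]
            _ = _ := by ring
      _ ≤ r * ∫⁻ ω, likelihood G A X t ω ^ 2 ∂P := h1
      _ ≤ r * r ^ t := by gcongr; exact ih (by omega)
      _ = r ^ (t + 1) := by ring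

/-- An event likely under the changed measure is not too unlikely under the original one. -/
theorem le_measure_of_withDensity [IsProbabilityMeasure P] (h : IsAdaptive P ν T A X)
    {G : Fin K → ℝ → ℝ≥0∞} (hG : ∀ a, Measurable (G a)) {r : ℝ≥0∞} (hr0 : r ≠ 0) (hr : r ≠ ∞)
    (hG2 : ∀ a, ∫⁻ x, G a x ^ 2 ∂(ν a) ≤ r) {M : ℝ≥0∞} (hM0 : M ≠ 0) (hM : M ≠ ∞) (S : Set Ω) :
    P.withDensity (likelihood G A X T) S ≤ M * P S + r ^ T / M := by
  have hLm : Measurable (likelihood G A X T) :=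
    (measurable_likelihood hG T).mono (h.history_le le_rfl) le_rfl
  rw [withDensity_apply']
  -- Truncation of the likelihood ratio at `M`; the part above `M` is paid for by the second moment.
  have hpt : ∀ x : ℝ≥0∞, x ≤ M + x ^ 2 / M := by
    intro x
    rcases le_total x M with hx | hx
    · exact hx.trans le_self_add
    · refine le_add_left ?_
      rw [ENNReal.le_div_iff_mul_le (Or.inl hM0) (Or.inl hM), sq]
      gcongr
  calc ∫⁻ ω in S, likelihood G A X T ω ∂P
      ≤ ∫⁻ ω in S, (M + likelihood G A X T ω ^ 2 / M) ∂P := lintegral_mono fun ω => hpt _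
    _ = M * P S + ∫⁻ ω in S, likelihood G A X T ω ^ 2 / M ∂P := by
        rw [lintegral_add_left measurable_const]; simp
    _ ≤ M * P S + ∫⁻ ω, likelihood G A X T ω ^ 2 / M ∂P := by
        gcongr; exact Measure.restrict_le_self
    _ ≤ M * P S + r ^ T / M := by
        simp only [div_eq_mul_inv]
        rw [lintegral_mul_const _ (hLm.pow_const 2)]
        gcongr
        exact h.lintegral_likelihood_sq_le hG hr0 hr hG2 le_rfl

end IsAdaptive

/-- **Ville's inequality** for likelihood processes. -/
theorem IsAdaptive.mul_measure_exists_le_one [IsProbabilityMeasure P] (h : IsAdaptive P ν T A X)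
    {G : Fin K → ℝ → ℝ≥0∞} (hG : ∀ a, Measurable (G a)) (hG1 : ∀ a, ∫⁻ x, G a x ∂(ν a) ≤ 1)
    (c : ℝ≥0∞) : c * P {ω | ∃ t ≤ T, c ≤ likelihood G A X t ω} ≤ 1 := by
  have h1 : ∀ t ≤ T, ∫⁻ ω, frozenLikelihood G c A X t ω ∂P ≤ 1 := by
    intro t ht
    induction t with
    | zero => simp [frozenLikelihood]
    | succ t ih =>
      refine le_trans ?_ (ih (by omega))
      have hmp := (measurable_frozenLikelihood (A := A) (X := X) hG c t)
      set S : Set Ω := {ω | c ≤ frozenLikelihood G c A X t ω}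
      have hSh : MeasurableSet[history A X t] S := hmp measurableSet_Ici
      have hS : MeasurableSet S := h.history_le (by omega) _ hSh
      rw [← lintegral_add_compl _ hS, ← lintegral_add_compl (frozenLikelihood G c A X t) hS]
      -- On `S` the process no longer moves; off `S` it gains a factor of conditional mean at most
      -- one.
      refine add_le_add (le_of_eq ?_) ?_
      · refine setLIntegral_congr_fun hS fun ω hω => ?_
        have : c ≤ frozenLikelihood G c A X t ω := hω
        simp [frozenLikelihood, this]
      · rw [← lintegral_indicator hS.compl, ← lintegral_indicator hS.compl]
        refine le_trans (le_of_eq ?_) (h.lintegral_mul_le (t := t) ht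
          (Z := Sᶜ.indicator (frozenLikelihood G c A X t))
          ((hmp.indicator hSh.compl).mono le_sup_left le_rfl) hG hG1)
        refine lintegral_congr fun ω => ?_
        by_cases hω : c ≤ frozenLikelihood G c A X t ω
        · have : ω ∉ Sᶜ := by simpa [S] using hω
          simp [Set.indicator_of_notMem this]
        · have : ω ∈ Sᶜ := by simpa [S] using hω
          simp [Set.indicator_of_mem this, frozenLikelihood, hω]
  calc c * P {ω | ∃ t ≤ T, c ≤ likelihood G A X t ω}
      ≤ c * P {ω | c ≤ frozenLikelihood G c A X T ω} := by
        refine mul_le_mul_right (measure_mono ?_) c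
        rintro ω ⟨t, ht, hc⟩
        refine (frozenLikelihood_eq_or G c T ω).resolve_right fun h2 => ?_
        exact absurd hc (not_le.mpr (h2.2 t ht))
    _ ≤ ∫⁻ ω, frozenLikelihood G c A X T ω ∂P :=
        mul_meas_ge_le_lintegral ((measurable_frozenLikelihood hG c T).mono
          (h.history_le le_rfl) le_rfl) c
    _ ≤ 1 := h1 T le_rfl

end

/-! ### Deviations of the empirical means -/

/-- The measure `ρ`, recentred at `m`, is sub-Gaussian with variance proxy `C`. -/
def IsSubgaussianAt (ρ : Measure ℝ) (m C : ℝ) : Prop :=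
  ∀ l : ℝ, ∫⁻ x, ENNReal.ofReal (Real.exp (l * (x - m))) ∂ρ ≤ ENNReal.ofReal (Real.exp (C * l ^ 2 / 2))

section

variable {Ω : Type*} {K : ℕ} {A : ℕ → Ω → Fin K} {X : ℕ → Ω → ℝ}

/-- The sum of the rewards received from arm `a` in the rounds `1, …, t`, each reduced by `m`. -/
noncomputable def deviation (A : ℕ → Ω → Fin K) (X : ℕ → Ω → ℝ) (a : Fin K) (m : ℝ) (t : ℕ)
    (ω : Ω) : ℝ :=
  ∑ s ∈ (Finset.Icc 1 t).filter (fun s => A s ω = a), (X s ω - m)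

theorem filter_Icc_succ (a : Fin K) (t : ℕ) (ω : Ω) :
    (Finset.Icc 1 (t + 1)).filter (fun s => A s ω = a) =
      if A (t + 1) ω = a then insert (t + 1) ((Finset.Icc 1 t).filter (fun s => A s ω = a))
      else (Finset.Icc 1 t).filter (fun s => A s ω = a) := by
  rw [← Finset.insert_Icc_right_eq_Icc_add_one (by omega), Finset.filter_insert]

theorem pulls_succ (a : Fin K) (t : ℕ) (ω : Ω) :
    pulls A a (t + 1) ω = pulls A a t ω + if A (t + 1) ω = a then 1 else 0 := by
  unfold pulls
  rw [filter_Icc_succ]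
  split_ifs with h
  · rw [Finset.card_insert_of_notMem (by simp)]
  · rfl

theorem deviation_succ (a : Fin K) (m : ℝ) (t : ℕ) (ω : Ω) :
    deviation A X a m (t + 1) ω =
      deviation A X a m t ω + if A (t + 1) ω = a then X (t + 1) ω - m else 0 := by
  unfold deviation
  rw [filter_Icc_succ]
  split_ifs with h
  · rw [Finset.sum_insert (by simp), add_comm]
  · simp

theorem empMean_eq (a : Fin K) (m : ℝ) (t : ℕ) (ω : Ω) (h : 0 < pulls A a t ω) :
    empMean A X a t ω = m + deviation A X a m t ω / pulls A a t ω := by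
  have h' : (pulls A a t ω : ℝ) ≠ 0 := by positivity
  unfold empMean deviation
  rw [Finset.sum_sub_distrib, Finset.sum_const, nsmul_eq_mul]
  change _ = m + (_ - (pulls A a t ω : ℝ) * m) / _
  field_simp
  ring

theorem pulls_le (a : Fin K) (t : ℕ) (ω : Ω) : pulls A a t ω ≤ t := by
  simpa [pulls] using Finset.card_filter_le (Finset.Icc 1 t) (fun s => A s ω = a)

theorem pulls_mono (a : Fin K) {s t : ℕ} (h : s ≤ t) (ω : Ω) : pulls A a s ω ≤ pulls A a t ω :=
  Finset.card_le_card (Finset.filter_subset_filter _ (Finset.Icc_subset_Icc_right h))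

theorem sum_pulls (t : ℕ) (ω : Ω) : ∑ a, pulls A a t ω = t := by
  have := Finset.card_eq_sum_card_fiberwise (s := Finset.Icc 1 t) (t := Finset.univ)
    (f := fun s => A s ω) (by intro x _; simp)
  simpa [pulls] using this.symm

/-- The exponential weight of a reward from arm `a`. -/
noncomputable def expWeight (a : Fin K) (m C l : ℝ) (b : Fin K) (x : ℝ) : ℝ≥0∞ :=
  if b = a then ENNReal.ofReal (Real.exp (l * (x - m) - C * l ^ 2 / 2)) else 1

/-- The exponential supermartingale of an arm is a likelihood process with unnormalised weights, so
Ville's inequality covers it. -/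
theorem likelihood_expWeight (a : Fin K) (m C l : ℝ) (t : ℕ) (ω : Ω) :
    likelihood (expWeight a m C l) A X t ω =
      ENNReal.ofReal (Real.exp (l * deviation A X a m t ω - C * l ^ 2 / 2 * pulls A a t ω)) := by
  induction t with
  | zero => simp [likelihood, deviation, pulls]
  | succ t ih =>
    rw [likelihood, ih, expWeight, deviation_succ, pulls_succ]
    split_ifs with h
    · rw [← ENNReal.ofReal_mul (Real.exp_nonneg _), ← Real.exp_add]
      congr 2
      push_cast
      ring
    · simp

theorem measurable_expWeight (a : Fin K) (m C l : ℝ) (b : Fin K) :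
    Measurable (expWeight a m C l b) := by
  unfold expWeight
  split_ifs
  · fun_prop
  · exact measurable_const

theorem lintegral_expWeight_le {ν : Fin K → Measure ℝ} [∀ b, IsProbabilityMeasure (ν b)]
    {a : Fin K} {m C : ℝ} (h : IsSubgaussianAt (ν a) m C) (l : ℝ) (b : Fin K) :
    ∫⁻ x, expWeight a m C l b x ∂(ν b) ≤ 1 := by
  unfold expWeight
  split_ifs with hb
  · subst hb
    have : ∀ x : ℝ, ENNReal.ofReal (Real.exp (l * (x - m) - C * l ^ 2 / 2)) =
        ENNReal.ofReal (Real.exp (-(C * l ^ 2 / 2))) * ENNReal.ofReal (Real.exp (l * (x - m))) := by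
      intro x
      rw [← ENNReal.ofReal_mul (Real.exp_nonneg _), ← Real.exp_add]
      ring_nf
    simp_rw [this]
    rw [lintegral_const_mul _ (by fun_prop)]
    calc _ ≤ ENNReal.ofReal (Real.exp (-(C * l ^ 2 / 2))) *
          ENNReal.ofReal (Real.exp (C * l ^ 2 / 2)) := by gcongr; exact h l
      _ = 1 := by
        rw [← ENNReal.ofReal_mul (Real.exp_nonneg _), ← Real.exp_add]
        simp
  · simp

end

namespace IsAdaptive

variable {Ω : Type*} [MeasurableSpace Ω] {K : ℕ} {P : Measure Ω} [IsProbabilityMeasure P]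
  {ν : Fin K → Measure ℝ} [∀ b, IsProbabilityMeasure (ν b)] {T : ℕ}
  {A : ℕ → Ω → Fin K} {X : ℕ → Ω → ℝ} {a : Fin K} {m C : ℝ}

theorem measure_exists_le_exp_neg (h : IsAdaptive P ν T A X) (hs : IsSubgaussianAt (ν a) m C)
    (l y : ℝ) :
    P {ω | ∃ t ≤ T, y ≤ l * deviation A X a m t ω - C * l ^ 2 / 2 * pulls A a t ω} ≤
      ENNReal.ofReal (Real.exp (-y)) := by
  have h1 := h.mul_measure_exists_le_one (measurable_expWeight a m C l)
    (lintegral_expWeight_le hs l) (ENNReal.ofReal (Real.exp y))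
  have h2 : {ω | ∃ t ≤ T, y ≤ l * deviation A X a m t ω - C * l ^ 2 / 2 * pulls A a t ω} ⊆
      {ω | ∃ t ≤ T, ENNReal.ofReal (Real.exp y) ≤
        likelihood (expWeight a m C l) A X t ω} := by
    rintro ω ⟨t, ht, hy⟩
    refine ⟨t, ht, ?_⟩
    rw [likelihood_expWeight]
    exact ENNReal.ofReal_le_ofReal (Real.exp_le_exp.mpr hy)
  refine (measure_mono h2).trans ?_
  rw [Real.exp_neg, ENNReal.ofReal_inv_of_pos (Real.exp_pos _), ENNReal.le_inv_iff_mul_le, mul_comm]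
  exact h1

theorem measure_exists_abs_le_exp_neg (h : IsAdaptive P ν T A X)
    (hs : IsSubgaussianAt (ν a) m C) (l y : ℝ) :
    P {ω | ∃ t ≤ T, y ≤ l * |deviation A X a m t ω| - C * l ^ 2 / 2 * pulls A a t ω} ≤
      ENNReal.ofReal (2 * Real.exp (-y)) := by
  have h2 : {ω | ∃ t ≤ T, y ≤ l * |deviation A X a m t ω| - C * l ^ 2 / 2 * pulls A a t ω} ⊆
      {ω | ∃ t ≤ T, y ≤ l * deviation A X a m t ω - C * l ^ 2 / 2 * pulls A a t ω} ∪
      {ω | ∃ t ≤ T, y ≤ (-l) * deviation A X a m t ω - C * (-l) ^ 2 / 2 * pulls A a t ω} := by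
    rintro ω ⟨t, ht, hy⟩
    rcases abs_choice (deviation A X a m t ω) with h3 | h3 <;> rw [h3] at hy
    · exact Or.inl ⟨t, ht, hy⟩
    · exact Or.inr ⟨t, ht, by simpa using hy⟩
  refine (measure_mono h2).trans ((measure_union_le _ _).trans ?_)
  rw [two_mul, ENNReal.ofReal_add (Real.exp_nonneg _) (Real.exp_nonneg _)]
  exact add_le_add (h.measure_exists_le_exp_neg hs l y) (h.measure_exists_le_exp_neg hs (-l) y)

/-- The empirical mean of arm `a` is close to the mean at all times when the arm has been pulled
at least `N` times. -/
theorem measure_exists_mul_le_abs_deviation (h : IsAdaptive P ν T A X)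
    (hs : IsSubgaussianAt (ν a) m C) (hC : 0 < C) {x : ℝ} (hx : 0 < x) (N : ℝ) :
    P {ω | ∃ t ≤ T, N ≤ pulls A a t ω ∧ x * pulls A a t ω ≤ |deviation A X a m t ω|} ≤
      ENNReal.ofReal (2 * Real.exp (-(x ^ 2 * N / (2 * C)))) := by
  -- The slope `l = x / C` maximizes `l x - C l² / 2`, with value `x² / (2C)`.
  refine (measure_mono ?_).trans (h.measure_exists_abs_le_exp_neg hs (x / C) (x ^ 2 * N / (2 * C)))
  rintro ω ⟨t, ht, hN, hd⟩
  refine ⟨t, ht, ?_⟩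
  set n : ℝ := (pulls A a t ω : ℝ)
  calc x ^ 2 * N / (2 * C) ≤ x ^ 2 * n / (2 * C) := by gcongr
    _ = x / C * (x * n) - C * (x / C) ^ 2 / 2 * n := by field_simp; ring
    _ ≤ _ := by gcongr

/-- One peeling block. The slope `s / (C M)` is optimal for `M` pulls, and fewer pulls only help.
The level uses `M / 2` because the block will be `M / 2 < n ≤ M`. -/
theorem measure_exists_block (h : IsAdaptive P ν T A X) (hs : IsSubgaussianAt (ν a) m C)
    (hC : 0 < C) {c M y : ℝ} (hc : 0 < c) (hM : 0 < M) (hy : 0 ≤ y) :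
    P {ω | ∃ t ≤ T, (pulls A a t ω : ℝ) ≤ M ∧ c * √(M / 2 * y) ≤ |deviation A X a m t ω|} ≤
      ENNReal.ofReal (2 * Real.exp (-(c ^ 2 / (4 * C) * y))) := by
  set s := c * √(M / 2 * y) with hs_def
  have hs2 : s ^ 2 = c ^ 2 * (M / 2 * y) := by
    rw [hs_def, mul_pow, Real.sq_sqrt (by positivity)]
  have hs0 : 0 ≤ s := by positivity
  refine (measure_mono ?_).trans
    (h.measure_exists_abs_le_exp_neg hs (s / (C * M)) (c ^ 2 / (4 * C) * y))
  rintro ω ⟨t, ht, hN, hd⟩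
  refine ⟨t, ht, ?_⟩
  calc c ^ 2 / (4 * C) * y = s / (C * M) * s - C * (s / (C * M)) ^ 2 / 2 * M := by
        rw [div_pow, hs2, show s / (C * M) * s = s ^ 2 / (C * M) by ring, hs2]; field_simp; ring
    _ ≤ _ := by gcongr

/-- Peeling into dyadic blocks of pull counts below `ε T`. Since the threshold involves `log(T/n)`,
block `i` fails with probability at most `2 (ε 2⁻ⁱ / c')^p`, where `p = c² / (4C)`. These sum
geometrically, to a bound free of `T` and vanishing with `ε`. -/
theorem measure_exists_sqrt_log_le_abs_deviation (h : IsAdaptive P ν T A X)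
    (hs : IsSubgaussianAt (ν a) m C) (hC : 0 < C) {c c' ε : ℝ} (hc : 0 < c) (hε : 0 < ε)
    (hε' : ε ≤ c') :
    P {ω | ∃ t ≤ T, 0 < pulls A a t ω ∧ (pulls A a t ω : ℝ) ≤ ε * T ∧
        c * √(pulls A a t ω * Real.log (c' * T / pulls A a t ω)) ≤ |deviation A X a m t ω|} ≤
      ENNReal.ofReal (2 * (ε / c') ^ (c ^ 2 / (4 * C)) * (1 - (1 / 2) ^ (c ^ 2 / (4 * C)))⁻¹) := by
  have hc' : 0 < c' := hε.trans_le hε'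
  set p := c ^ 2 / (4 * C) with hp_def
  have hp : 0 < p := by positivity
  set q : ℝ := (1 / 2) ^ p with hq_def
  have hq0 : 0 ≤ q := by positivity
  have hq1 : q < 1 := Real.rpow_lt_one (by norm_num) (by norm_num) hp
  have hsub : {ω | ∃ t ≤ T, 0 < pulls A a t ω ∧ (pulls A a t ω : ℝ) ≤ ε * T ∧
        c * √(pulls A a t ω * Real.log (c' * T / pulls A a t ω)) ≤ |deviation A X a m t ω|} ⊆
      ⋃ i : ℕ, {ω | ∃ t ≤ T, (0 < T ∧ (pulls A a t ω : ℝ) ≤ ε * T * (1 / 2) ^ i) ∧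
        c * √(ε * T * (1 / 2) ^ i / 2 * Real.log (c' / (ε * (1 / 2) ^ i))) ≤
          |deviation A X a m t ω|} := by
    rintro ω ⟨t, ht, h0, h1, h2⟩
    have hTn : 0 < T := h0.trans_le ((pulls_le a t ω).trans ht)
    have hT : (0 : ℝ) < T := by exact_mod_cast hTn
    have h0' : (0 : ℝ) < pulls A a t ω := by exact_mod_cast h0
    set n : ℝ := (pulls A a t ω : ℝ)
    obtain ⟨i, hi1, hi2⟩ := exists_nat_pow_near_of_lt_one (x := n / (ε * T)) (y := (1 / 2 : ℝ))
      (by positivity) ((div_le_one (by positivity)).mpr h1) (by norm_num) (by norm_num)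
    rw [lt_div_iff₀ (by positivity)] at hi1
    rw [div_le_iff₀ (by positivity)] at hi2
    refine Set.mem_iUnion.mpr ⟨i, t, ht, ⟨hTn, by linarith⟩, le_trans ?_ h2⟩
    have hlog0 : 0 ≤ Real.log (c' / (ε * (1 / 2) ^ i)) := by
      apply Real.log_nonneg
      rw [le_div_iff₀ (by positivity), one_mul]
      have : (1 / 2 : ℝ) ^ i ≤ 1 := pow_le_one₀ (by norm_num) (by norm_num)
      nlinarith
    have hratio : c' / (ε * (1 / 2) ^ i) ≤ c' * T / n := by
      rw [div_le_div_iff₀ (by positivity) h0']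
      nlinarith
    refine mul_le_mul_of_nonneg_left (Real.sqrt_le_sqrt (mul_le_mul ?_
      (Real.log_le_log (by positivity) hratio) hlog0 h0'.le)) hc.le
    rw [pow_succ] at hi1; linarith
  have hblock : ∀ i : ℕ, P {ω | ∃ t ≤ T,
      (0 < T ∧ (pulls A a t ω : ℝ) ≤ ε * T * (1 / 2) ^ i) ∧
        c * √(ε * T * (1 / 2) ^ i / 2 * Real.log (c' / (ε * (1 / 2) ^ i))) ≤
          |deviation A X a m t ω|} ≤ ENNReal.ofReal (2 * (ε / c') ^ p * q ^ i) := by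
    intro i
    rcases Nat.eq_zero_or_pos T with hT0 | hT0
    · simp [hT0]
    have hT : (0 : ℝ) < T := by exact_mod_cast hT0
    have hlog0 : 0 ≤ Real.log (c' / (ε * (1 / 2) ^ i)) := by
      apply Real.log_nonneg
      rw [le_div_iff₀ (by positivity), one_mul]
      have : (1 / 2 : ℝ) ^ i ≤ 1 := pow_le_one₀ (by norm_num) (by norm_num)
      nlinarith
    refine (measure_mono ?_).trans ((h.measure_exists_block hs hC hc
      (M := ε * T * (1 / 2) ^ i) (by positivity) hlog0).trans (le_of_eq ?_))
    · rintro ω ⟨t, ht, ⟨_, h1⟩, h2⟩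
      exact ⟨t, ht, h1, h2⟩
    · congr 1
      rw [mul_assoc]
      congr 1
      have e1 : -(p * Real.log (c' / (ε * (1 / 2) ^ i))) = Real.log (ε / c' * (1 / 2) ^ i) * p := by
        rw [show ε / c' * (1 / 2) ^ i = (c' / (ε * (1 / 2) ^ i))⁻¹ by field_simp, Real.log_inv]
        ring
      rw [e1, ← Real.rpow_def_of_pos (by positivity), Real.mul_rpow (by positivity) (by positivity),
        hq_def, ← Real.rpow_natCast, ← Real.rpow_natCast, ← Real.rpow_mul (by norm_num),
        ← Real.rpow_mul (by norm_num), mul_comm p]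
  refine (measure_mono hsub).trans ((measure_iUnion_le _).trans ((ENNReal.tsum_le_tsum hblock).trans ?_))
  rw [← ENNReal.ofReal_tsum_of_nonneg (fun i => by positivity)
    ((summable_geometric_of_lt_one hq0 hq1).mul_left _), tsum_mul_left,
    tsum_geometric_of_lt_one hq0 hq1]

end IsAdaptive

theorem exists_peeling_bound_le {C c c' δ B : ℝ} (hC : 0 < C) (hc : 0 < c) (hc' : 0 < c')
    (hδ : 0 < δ) (hB : 0 < B) : ∃ ε : ℝ, 0 < ε ∧ ε ≤ c' ∧ ε ≤ B ∧
      2 * (ε / c') ^ (c ^ 2 / (4 * C)) * (1 - (1 / 2) ^ (c ^ 2 / (4 * C)))⁻¹ ≤ δ := by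
  set p := c ^ 2 / (4 * C) with hp_def
  have hp : 0 < p := by positivity
  have h1 : Tendsto (fun ε : ℝ => 2 * (ε / c') ^ p * (1 - (1 / 2) ^ p)⁻¹) (nhds 0) (nhds 0) := by
    have : ContinuousAt (fun ε : ℝ => 2 * (ε / c') ^ p * (1 - (1 / 2) ^ p)⁻¹) 0 := by
      refine ContinuousAt.mul (ContinuousAt.mul continuousAt_const ?_) continuousAt_const
      exact (continuousAt_id.div_const c').rpow_const (Or.inr hp.le)
    simpa [ContinuousAt, Real.zero_rpow hp.ne'] using this
  have h2 : ∀ᶠ ε in nhdsWithin (0 : ℝ) (Set.Ioi 0),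
      2 * (ε / c') ^ p * (1 - (1 / 2) ^ p)⁻¹ ≤ δ :=
    (h1.mono_left nhdsWithin_le_nhds).eventually (eventually_le_nhds hδ)
  obtain ⟨ε, h3, h4⟩ := (h2.and (Filter.eventually_mem_set.mpr
    (Ioc_mem_nhdsGT (lt_min hc' hB)))).exists
  exact ⟨ε, h4.1, h4.2.trans (min_le_left _ _), h4.2.trans (min_le_right _ _), h3⟩

/-! ### Index algorithms with a small bonus -/

section

variable {Ω : Type*} {K : ℕ} {A : ℕ → Ω → Fin K} {X : ℕ → Ω → ℝ} {U : Index K} {T : ℕ}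

/-- At its last pull an arm had a maximal index and only one pull fewer than at the end, so a large
final count gives a small bonus at that moment. -/
theorem exists_last_pull (b : Fin K) (s : ℕ) (ω : Ω) (h : 0 < pulls A b s ω) :
    ∃ t < s, A (t + 1) ω = b ∧ pulls A b t ω + 1 = pulls A b s ω := by
  induction s with
  | zero => simp [pulls] at h
  | succ s ih =>
    by_cases hb : A (s + 1) ω = b
    · exact ⟨s, s.lt_succ_self, hb, by rw [pulls_succ, if_pos hb]⟩
    · rw [pulls_succ, if_neg hb, add_zero] at h ⊢
      obtain ⟨t, ht, h1⟩ := ih h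
      exact ⟨t, by omega, h1⟩

theorem FollowsIndex.pulls_pos (h : FollowsIndex U T A X) {t : ℕ} (hKt : K ≤ t) (htT : t ≤ T)
    (b : Fin K) (ω : Ω) : 0 < pulls A b t ω := by
  have := h.init (hKt.trans htT) ω b
  have := pulls_mono (A := A) b hKt ω
  omega

end

/-- The index lies between the empirical mean and the empirical mean plus
`√(c log(T / n_b) / n_b)`. -/
def HasLogBonus {K : ℕ} (U : Index K) (c : ℝ) : Prop :=
  ∀ (T t : ℕ) (n : Fin K → ℕ) (m : Fin K → ℝ) (b : Fin K), (∀ j, 0 < n j) → n b ≤ t → t ≤ T →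
    m b ≤ U T t n m b ∧ U T t n m b ≤ m b + √(c * Real.log (T / n b) / n b)

/-- With high probability, after a small fraction of the rounds, the index of a best arm exceeds
the mean of the arm unless the arm has been pulled in a positive fraction of the rounds. -/
def IsPersistent {K : ℕ} (U : Index K) (C : ℝ) : Prop :=
  ∀ γ δ : ℝ, 0 < γ → γ ≤ 1 → 0 < δ → ∃ ε : ℝ, 0 < ε ∧ ∃ T₀ : ℕ,
    ∀ (Ω : Type u) [MeasurableSpace Ω] (P : Measure Ω) [IsProbabilityMeasure P]
      (ν : Fin K → Measure ℝ) [∀ b, IsProbabilityMeasure (ν b)] (T : ℕ) (A : ℕ → Ω → Fin K)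
      (X : ℕ → Ω → ℝ) (m : Fin K → ℝ) (a : Fin K), T₀ ≤ T → IsAdaptive P ν T A X →
      FollowsIndex U T A X → (∀ b, IsSubgaussianAt (ν b) (m b) C) → (∀ b, m b ≤ m a) →
      P {ω | ∃ t, K ≤ t ∧ γ * T ≤ t ∧ t < T ∧ (pulls A a t ω : ℝ) ≤ ε * T ∧
        indexAt U T A X a t ω < m a} ≤ ENNReal.ofReal δ

theorem abs_div_lt_of_lt_sqrt {c d n l : ℝ} (hn : 0 < n) (h : |d| < c * √(n * l)) :
    |d / n| < c * √(l / n) := by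
  rw [abs_div, abs_of_pos hn, div_lt_iff₀ hn]
  have : √(n * l) = √(l / n) * n := by
    rw [show n * l = l / n * n ^ 2 by field_simp, Real.sqrt_mul' _ (by positivity),
      Real.sqrt_sq hn.le]
  rwa [this, ← mul_assoc] at h

/-- The bonus dominates the peeling threshold with `c = 1` and `c' = γ / K`, so the empirical mean
plus the bonus cannot fall below the true mean while deviations are below that threshold. -/
theorem isPersistent_of_log_le {K : ℕ} {U : Index K} {C : ℝ} (hC : 0 < C) (hK : 0 < K)
    (hU : ∀ (γ : ℝ) (T t : ℕ) (n : Fin K → ℕ) (m : Fin K → ℝ) (b : Fin K), 0 < γ → γ ≤ 1 →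
      (∀ j, 0 < n j) → n b ≤ t → t ≤ T → γ * T ≤ t →
      m b + √(Real.log (γ * T / (K * n b)) / n b) ≤ U T t n m b) :
    IsPersistent.{u} U C := by
  intro γ δ hγ hγ1 hδ
  have hK' : (0 : ℝ) < K := by exact_mod_cast hK
  obtain ⟨ε, hε, hε1, -, hε2⟩ := exists_peeling_bound_le hC one_pos
    (show 0 < γ / K by positivity) hδ one_pos
  refine ⟨ε, hε, 0, fun Ω _ P _ ν _ T A X m a _ hA hF hs _ => ?_⟩
  refine (measure_mono ?_).trans ((hA.measure_exists_sqrt_log_le_abs_deviation (hs a) hC one_pos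
    hε hε1).trans (ENNReal.ofReal_le_ofReal hε2))
  rintro ω ⟨t, hKt, hγt, htT, hn, hlt⟩
  have hpos := hF.pulls_pos hKt htT.le (ω := ω)
  refine ⟨t, htT.le, hpos a, hn, ?_⟩
  by_contra! hlt2
  have hna : (0 : ℝ) < pulls A a t ω := by exact_mod_cast hpos a
  have h1 := abs_div_lt_of_lt_sqrt hna hlt2
  have h2 := hU γ T t (fun b => pulls A b t ω) (fun b => empMean A X b t ω) a hγ hγ1 hpos
    (pulls_le a t ω) htT.le hγt
  have h3 : indexAt U T A X a t ω =
    U T t (fun b => pulls A b t ω) (fun b => empMean A X b t ω) a := rfl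
  rw [← h3] at h2
  simp only [empMean_eq a (m a) t ω (hpos a)] at h2
  rw [show γ / K * T / (pulls A a t ω : ℝ) = γ * T / (K * pulls A a t ω) by field_simp] at h1
  have h4 := neg_abs_le (deviation A X a (m a) t ω / pulls A a t ω)
  linarith

/-- If arm `a` lagged at time `s`, some arm `b` would have at least `s / K` pulls. At the last pull
of `b` its bonus is at most a quarter of that of `a`, and deviations are at most half the respective
bonuses. With `B` the bonus of `a`, the index of `b` is then below `m b + 3B/8` and that of `a`
above `m a + B/2`, contradicting the choice of `b`. -/
theorem ocUcb_pulls_ge {Ω : Type*} {K : ℕ} (hK : 0 < K) {A : ℕ → Ω → Fin K} {X : ℕ → Ω → ℝ}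
    {η : ℝ} (hη : 0 < η) {T : ℕ} (hF : FollowsIndex (ocUcb K η) T A X) {m : Fin K → ℝ}
    {a : Fin K} (hm : ∀ b, m b ≤ m a) {ε : ℝ} (hε1 : ε ≤ 1) (ω : Ω)
    (hgood : ∀ b, ∀ t ≤ T, 0 < pulls A b t ω → (pulls A b t ω : ℝ) ≤ ε * T →
      |deviation A X b (m b) t ω| < √(2 * (1 + η)) / 2 *
        √(pulls A b t ω * Real.log (1 / (64 * K ^ 3) * T / pulls A b t ω)))
    (s : ℕ) (hKs : K ≤ s) (hs : (s : ℝ) ≤ ε * T) :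
    1 / (32 * K ^ 2) * (s : ℝ) ≤ pulls A a s ω := by
  have hK1 : (1 : ℝ) ≤ K := by exact_mod_cast hK
  have hK0 : (0 : ℝ) < K := by linarith
  induction s using Nat.strong_induction_on with
  | _ s ih =>
    -- No base case is needed: arm `a` has at least one pull, so lagging forces `s > 32 K²`.
    by_contra! hlt
    have hTR : (s : ℝ) ≤ T := hs.trans (mul_le_of_le_one_left (by positivity) hε1)
    have hsT : s ≤ T := by exact_mod_cast hTR
    have hpos := hF.pulls_pos hKs hsT (ω := ω)
    have hna1 : (1 : ℝ) ≤ pulls A a s ω := by exact_mod_cast hpos a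
    rw [one_div, inv_mul_eq_div, lt_div_iff₀ (by positivity)] at hlt
    have hs32 : 32 * (K : ℝ) ^ 2 ≤ s := by nlinarith [sq_nonneg (K : ℝ)]
    obtain ⟨b, hb⟩ : ∃ b, (s : ℝ) ≤ K * pulls A b s ω := by
      by_contra! hcon
      have h1 : ∑ b, (K : ℝ) * pulls A b s ω < ∑ _b : Fin K, (s : ℝ) :=
        Finset.sum_lt_sum_of_nonempty ⟨a, Finset.mem_univ a⟩ fun b _ => hcon b
      rw [← Finset.mul_sum, ← Nat.cast_sum, sum_pulls] at h1
      simp at h1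
    obtain ⟨t, hts, hAt, hbt⟩ := exists_last_pull b s ω (hpos b)
    have hbt' : (pulls A b t ω : ℝ) + 1 = pulls A b s ω := by exact_mod_cast hbt
    have hbt2 : (s : ℝ) ≤ 2 * K * pulls A b t ω := by
      rw [← hbt'] at hb; nlinarith
    have htb : (pulls A b t ω : ℝ) ≤ t := by exact_mod_cast pulls_le b t ω
    have hKt : K ≤ t := by
      have : (K : ℝ) ≤ t := by
        by_contra! hcon
        nlinarith [mul_le_mul_of_nonneg_left htb hK0.le]
      exact_mod_cast this
    have hts' : (t : ℝ) < s := by exact_mod_cast hts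
    have htT : t < T := hts.trans_le hsT
    have ht0 : (0 : ℝ) < t := by exact_mod_cast hK.trans_le hKt
    have hpt := hF.pulls_pos hKt htT.le (ω := ω)
    have hk0 : (0 : ℝ) < pulls A a t ω := by exact_mod_cast hpt a
    have hn0 : (0 : ℝ) < pulls A b t ω := by exact_mod_cast hpt b
    have hkle : (pulls A a t ω : ℝ) ≤ pulls A a s ω := by exact_mod_cast pulls_mono a hts.le ω
    -- The induction hypothesis at `t` makes `t` comparable to the count of `a`, so the peeling
    -- threshold, in `log(T/n)`, is at most half the bonus, in `log(T/t)`.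
    have hk : (t : ℝ) ≤ 32 * K ^ 2 * pulls A a t ω := by
      have := ih t hts hKt (hts'.le.trans hs)
      rw [one_div, inv_mul_eq_div, div_le_iff₀ (by positivity)] at this
      linarith
    have hopt := hF.optimism t hKt htT ω a
    rw [hAt] at hopt
    simp only [indexAt, ocUcb] at hopt
    rw [empMean_eq a (m a) t ω (hpt a), empMean_eq b (m b) t ω (hpt b)] at hopt
    set k : ℝ := (pulls A a t ω : ℝ) with hk_def
    set n : ℝ := (pulls A b t ω : ℝ) with hn_def
    set l : ℝ := Real.log (T / t) with hl_def
    have hTt : (t : ℝ) < T := by exact_mod_cast htT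
    have hl : 0 < l := Real.log_pos (by rwa [lt_div_iff₀ ht0, one_mul])
    have hT0 : (0 : ℝ) < T := ht0.trans hTt
    have hkn : 16 * k ≤ n := by
      by_contra! hcon
      nlinarith [mul_le_mul_of_nonneg_left hkle (sq_nonneg (K : ℝ)), mul_pos hK0 hk0,
        mul_le_mul_of_nonneg_left hK1 hK0.le]
    have key : ∀ r : ℝ, 0 < r → (t : ℝ) ≤ 32 * K ^ 2 * r → ∀ d : ℝ,
        |d| < √(2 * (1 + η)) / 2 * √(r * Real.log (1 / (64 * K ^ 3) * T / r)) →
        |d / r| < √(2 * (1 + η)) / 2 * √(l / r) := by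
      intro r hr htr d hd
      refine abs_div_lt_of_lt_sqrt hr (hd.trans_le ?_)
      have : 1 / (64 * (K : ℝ) ^ 3) * T / r ≤ T / t := by
        rw [div_mul_eq_mul_div, one_mul, div_div]
        have h64 : (t : ℝ) ≤ 64 * (K : ℝ) ^ 3 * r := by
          have : (K : ℝ) ^ 2 ≤ (K : ℝ) ^ 3 := pow_le_pow_right₀ hK1 (by norm_num)
          nlinarith
        gcongr
      have hle := Real.log_le_log (by positivity) this
      exact mul_le_mul_of_nonneg_left (Real.sqrt_le_sqrt
        (mul_le_mul_of_nonneg_left hle hr.le)) (by positivity)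
    have hda := key k hk0 hk _ (hgood a t htT.le (hpt a)
      ((hkle.trans (Nat.cast_le.mpr (pulls_le a s ω))).trans hs))
    have hdb := key n hn0 (by nlinarith) _ (hgood b t htT.le (hpt b)
      (htb.trans (hts'.le.trans hs)))
    have hsn : √(l / n) ≤ √(l / k) / 4 := by
      rw [show √(l / k) / 4 = √(l / (16 * k)) by
        rw [mul_comm, ← div_div, Real.sqrt_div' _ (by norm_num : (0 : ℝ) ≤ 16),
          show (16 : ℝ) = 4 ^ 2 by norm_num, Real.sqrt_sq (by norm_num)]]
      exact Real.sqrt_le_sqrt (div_le_div_of_nonneg_left hl.le (by positivity) hkn)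
    have hR : 0 < √(l / k) := Real.sqrt_pos.mpr (by positivity)
    have hc : 0 < √(2 * (1 + η)) := Real.sqrt_pos.mpr (by linarith)
    have hsplit : ∀ r : ℝ, √(2 * (1 + η) / r * l) = √(2 * (1 + η)) * √(l / r) := by
      intro r
      rw [← Real.sqrt_mul (by linarith)]
      congr 1; ring
    rw [hsplit, hsplit] at hopt
    have h1 := (abs_lt.mp hda).1
    have h2 := (abs_lt.mp hdb).2
    have h3 := mul_le_mul_of_nonneg_left hsn hc.le
    have h4 := mul_pos hc hR
    linarith [hm b]

/-- Off the bad deviation events, arm `a` already has linearly many pulls at time `⌊ε T⌋ ≤ γ T`, so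
the low-count case never occurs and its index need not be examined. The factor 1/4 absorbs the floor
and gives strictness. -/
theorem ocUcb_isPersistent {K : ℕ} (hK : 0 < K) {η : ℝ} (hη : 0 < η) {C : ℝ} (hC : 0 < C) :
    IsPersistent.{u} (ocUcb K η) C := by
  intro γ δ hγ hγ1 hδ
  have hK1 : (1 : ℝ) ≤ K := by exact_mod_cast hK
  have hK0 : (0 : ℝ) < K := by linarith
  have hc : 0 < √(2 * (1 + η)) / 2 := by
    have : 0 < √(2 * (1 + η)) := Real.sqrt_pos.mpr (by linarith)
    linarith
  obtain ⟨ε, hε, hε1, hε2, hε3⟩ := exists_peeling_bound_le hC hc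
    (show (0 : ℝ) < 1 / (64 * K ^ 3) by positivity) (show 0 < δ / K by positivity) hγ
  refine ⟨1 / (32 * K ^ 2) * ε / 4, by positivity, ⌈(K + 2) / ε⌉₊,
    fun Ω _ P _ ν _ T A X m a hT hA hF hs hm => ?_⟩
  have hT' : (K : ℝ) + 2 ≤ ε * T := by
    have := (Nat.le_ceil _).trans (Nat.cast_le (α := ℝ).mpr hT)
    rwa [div_le_iff₀ hε, mul_comm] at this
  set S : Fin K → Set Ω := fun b => {ω | ∃ t ≤ T, 0 < pulls A b t ω ∧
    (pulls A b t ω : ℝ) ≤ ε * T ∧ √(2 * (1 + η)) / 2 *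
      √(pulls A b t ω * Real.log (1 / (64 * K ^ 3) * T / pulls A b t ω)) ≤
        |deviation A X b (m b) t ω|} with hS
  have hSb : ∀ b, P (S b) ≤ ENNReal.ofReal (δ / K) := fun b =>
    (hA.measure_exists_sqrt_log_le_abs_deviation (hs b) hC hc hε hε1).trans
      (ENNReal.ofReal_le_ofReal hε3)
  calc _ ≤ P (⋃ b, S b) := measure_mono ?_
    _ ≤ ∑ b, P (S b) := measure_iUnion_fintype_le _ _
    _ ≤ ∑ _b : Fin K, ENNReal.ofReal (δ / K) := Finset.sum_le_sum fun b _ => hSb b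
    _ = ENNReal.ofReal δ := by
      rw [← ENNReal.ofReal_sum_of_nonneg (fun _ _ => by positivity)]
      simp [mul_div_cancel₀ _ hK0.ne']
  rintro ω ⟨t, hKt, hγt, htT, hn, -⟩
  by_contra hnot
  have hgood : ∀ b, ∀ t ≤ T, 0 < pulls A b t ω → (pulls A b t ω : ℝ) ≤ ε * T →
      |deviation A X b (m b) t ω| < √(2 * (1 + η)) / 2 *
        √(pulls A b t ω * Real.log (1 / (64 * K ^ 3) * T / pulls A b t ω)) := by
    intro b t ht h0 h1
    by_contra! hcon
    exact hnot (Set.mem_iUnion.mpr ⟨b, t, ht, h0, h1, hcon⟩)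
  have hfl := Nat.floor_le (show 0 ≤ ε * T by positivity)
  have hfl2 := Nat.lt_floor_add_one (ε * T)
  have h1 := ocUcb_pulls_ge hK hη hF hm (hε2.trans hγ1) ω hgood ⌊ε * T⌋₊
    (Nat.le_floor (by linarith)) hfl
  have hst : ⌊ε * T⌋₊ ≤ t := by
    have : (⌊ε * T⌋₊ : ℝ) ≤ t := hfl.trans (le_trans (by gcongr) hγt)
    exact_mod_cast this
  have h2 : (pulls A a ⌊ε * T⌋₊ ω : ℝ) ≤ pulls A a t ω := by
    exact_mod_cast pulls_mono a hst ω
  have h3 : ε * T / 2 ≤ (⌊ε * T⌋₊ : ℝ) := by linarith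
  have h4 : (0 : ℝ) < 1 / (32 * K ^ 2) := by positivity
  have h5 : (0 : ℝ) < ε * T := by linarith
  nlinarith [mul_le_mul_of_nonneg_left h3 h4.le, mul_pos h4 h5]

/-- If the mean of one arm exceeds the common mean of the other arms by a large multiple of
`1 / √T`, then that arm is likely to be pulled in most rounds. -/
theorem exists_measure_pulls_lt_le_half {K : ℕ} (hK : 0 < K) {U : Index K} {c C : ℝ} (hc : 0 < c)
    (hC : 0 < C) (hU : HasLogBonus U c) (hp : IsPersistent.{u} U C) :
    ∃ D : ℝ, ∃ T₀ : ℕ, ∀ (Ω : Type u) [MeasurableSpace Ω] (P : Measure Ω)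
      [IsProbabilityMeasure P] (ν : Fin K → Measure ℝ) [∀ b, IsProbabilityMeasure (ν b)] (T : ℕ)
      (A : ℕ → Ω → Fin K) (X : ℕ → Ω → ℝ) (m : Fin K → ℝ) (a : Fin K) (Δ : ℝ), T₀ ≤ T →
      IsAdaptive P ν T A X → FollowsIndex U T A X → (∀ b, IsSubgaussianAt (ν b) (m b) C) →
      0 < Δ → D ≤ Δ ^ 2 * T → (∀ b ≠ a, m b + Δ = m a) →
      P {ω | (pulls A a T ω : ℝ) < 9 / 10 * T} ≤ ENNReal.ofReal (1 / 2) := by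
  have hK1 : (1 : ℝ) ≤ K := by exact_mod_cast hK
  have hK0 : (0 : ℝ) < K := by linarith
  -- Chosen so that `K` arms with fewer than `2 γ T` pulls each account for at most `T / 10` rounds.
  set γ : ℝ := 1 / (20 * K) with hγ_def
  have hγ : 0 < γ := by positivity
  have hγ1 : γ ≤ 1 := by rw [hγ_def, div_le_one (by positivity)]; linarith
  have hγK : γ * K = 1 / 20 := by rw [hγ_def]; field_simp
  obtain ⟨ε, hε, T₁, hT₁⟩ := hp γ (1 / 4) hγ hγ1 (by norm_num)
  set β := min γ ε with hβ_def
  have hβ : 0 < β := lt_min hγ hε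
  have hlogγ : 0 ≤ Real.log (1 / γ) := Real.log_nonneg (by rw [le_div_iff₀ hγ]; linarith)
  -- The first term makes the bonus after `γ T` pulls at most `Δ / 4`; the second makes each `S b`
  -- have probability at most `1 / (4K)`. The lower bound on `T` gives `γ T ≥ K`, placing the last
  -- pull of `b` after initialization.
  refine ⟨16 * (c * Real.log (1 / γ)) / γ + 256 * C * K / β + 1, max T₁ (20 * K * K),
    fun Ω _ P _ ν _ T A X m a Δ hT hA hF hs hΔ hD hm => ?_⟩
  have hTK : (20 : ℝ) * K * K ≤ T := by exact_mod_cast (le_max_right _ _).trans hT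
  have hT0 : (0 : ℝ) < T := by nlinarith
  have hγT : (K : ℝ) ≤ γ * T := by
    rw [hγ_def, div_mul_eq_mul_div, le_div_iff₀ (by positivity)]; linarith
  have hma : ∀ b, m b ≤ m a := fun b => by
    by_cases hb : b = a
    · rw [hb]
    · linarith [hm b hb]
  have hD1 : 16 * (c * Real.log (1 / γ)) / γ ≤ Δ ^ 2 * T := by
    have : 0 ≤ 256 * C * K / β := by positivity
    linarith
  have hD2 : 256 * C * K / β ≤ Δ ^ 2 * T := by
    have : 0 ≤ 16 * (c * Real.log (1 / γ)) / γ := by positivity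
    linarith
  set E : Set Ω := {ω | ∃ t, K ≤ t ∧ γ * T ≤ t ∧ t < T ∧ (pulls A a t ω : ℝ) ≤ ε * T ∧
        indexAt U T A X a t ω < m a} with hE_def
  have hE : P E ≤ ENNReal.ofReal (1 / 4) :=
    hT₁ Ω P ν T A X m a ((le_max_left _ _).trans hT) hA hF hs hma
  set S : Fin K → Set Ω := fun b => {ω | ∃ t ≤ T, β * T ≤ pulls A b t ω ∧
    Δ / 4 * pulls A b t ω ≤ |deviation A X b (m b) t ω|} with hS_def
  have hS : ∀ b, P (S b) ≤ ENNReal.ofReal (1 / (4 * K)) := fun b => by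
    refine (hA.measure_exists_mul_le_abs_deviation (hs b) hC
      (show 0 < Δ / 4 by positivity) (β * T)).trans (ENNReal.ofReal_le_ofReal ?_)
    set y := (Δ / 4) ^ 2 * (β * T) / (2 * C) with hy_def
    have hy : 8 * K ≤ y := by
      rw [div_le_iff₀ hβ] at hD2
      rw [hy_def, le_div_iff₀ (by positivity)]
      nlinarith
    rw [Real.exp_neg, ← div_eq_mul_inv, div_le_div_iff₀ (Real.exp_pos _) (by positivity)]
    have := Real.add_one_le_exp y
    linarith
  have hsub : {ω | (pulls A a T ω : ℝ) < 9 / 10 * T} ⊆ E ∪ ⋃ b, S b := by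
    intro ω hω
    have hω' : (pulls A a T ω : ℝ) < 9 / 10 * T := hω
    by_contra hnot
    rw [Set.mem_union, not_or, Set.mem_iUnion, not_exists] at hnot
    obtain ⟨hnE, hnS⟩ := hnot
    have hline : ∀ b, ∀ t ≤ T, β * T ≤ pulls A b t ω → 0 < pulls A b t ω →
        |deviation A X b (m b) t ω / pulls A b t ω| < Δ / 4 := by
      intro b t ht h1 h2
      have h2' : (0 : ℝ) < pulls A b t ω := by exact_mod_cast h2
      rw [abs_div, abs_of_pos h2', div_lt_iff₀ h2']
      by_contra! hcon
      exact hnS b ⟨t, ht, h1, hcon⟩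
    obtain ⟨b, hba, hb⟩ : ∃ b, b ≠ a ∧ 2 * γ * T ≤ pulls A b T ω := by
      by_contra! hcon
      have h1 : (∑ b, (pulls A b T ω : ℝ)) = T := by exact_mod_cast sum_pulls T ω
      rw [← Finset.add_sum_erase _ _ (Finset.mem_univ a)] at h1
      have h2 : ∑ b ∈ Finset.univ.erase a, (pulls A b T ω : ℝ) ≤
          (Finset.univ.erase a).card • (2 * γ * T) :=
        Finset.sum_le_card_nsmul _ _ _ fun b hb => (hcon b (Finset.ne_of_mem_erase hb)).le
      have h3 : ((Finset.univ.erase a).card : ℝ) ≤ K := by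
        exact_mod_cast (Finset.card_le_univ _).trans (by simp)
      rw [nsmul_eq_mul] at h2
      have h4 : ((Finset.univ.erase a).card : ℝ) * (2 * γ * T) ≤ K * (2 * γ * T) := by gcongr
      have h5 : K * (2 * γ * T) = T / 10 := by
        rw [show K * (2 * γ * T) = 2 * (γ * K) * T by ring, hγK]; ring
      linarith
    have hb0 : 0 < pulls A b T ω := by
      have : (0 : ℝ) < pulls A b T ω := lt_of_lt_of_le (by positivity) hb
      exact_mod_cast this
    obtain ⟨t, htT, hAt, hbt⟩ := exists_last_pull b T ω hb0
    have hbt' : (pulls A b t ω : ℝ) + 1 = pulls A b T ω := by exact_mod_cast hbt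
    have hbt2 : γ * T ≤ pulls A b t ω := by linarith
    have htb : (pulls A b t ω : ℝ) ≤ t := by exact_mod_cast pulls_le b t ω
    have hKt : K ≤ t := by exact_mod_cast hγT.trans (hbt2.trans htb)
    have hpt := hF.pulls_pos hKt htT.le (ω := ω)
    have hn0 : (0 : ℝ) < pulls A b t ω := by exact_mod_cast hpt b
    have hopt := hF.optimism t hKt htT ω a
    rw [hAt] at hopt
    have hβT : β * T ≤ γ * T := by gcongr; exact min_le_left _ _
    have hUb : indexAt U T A X b t ω < m b + Δ / 2 := by
      refine ((hU T t (fun b => pulls A b t ω) (fun b => empMean A X b t ω) b hpt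
        (pulls_le b t ω) htT.le).2).trans_lt ?_
      have h1 := (abs_lt.mp (hline b t htT.le (hβT.trans hbt2) (hpt b))).2
      have h2 : √(c * Real.log (T / pulls A b t ω) / pulls A b t ω) ≤ Δ / 4 := by
        rw [Real.sqrt_le_left (by positivity), div_le_iff₀ hn0]
        have h3 : Real.log (T / pulls A b t ω) ≤ Real.log (1 / γ) := by
          refine Real.log_le_log (by positivity) ?_
          rw [div_le_div_iff₀ hn0 hγ]; linarith
        rw [div_le_iff₀ hγ] at hD1
        calc c * Real.log (T / pulls A b t ω) ≤ c * Real.log (1 / γ) := by gcongr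
          _ ≤ (Δ / 4) ^ 2 * (γ * T) := by nlinarith
          _ ≤ _ := by gcongr
      simp only [empMean_eq b (m b) t ω (hpt b)]
      linarith
    have hUa : m a - Δ / 2 < indexAt U T A X a t ω := by
      by_cases hna : (pulls A a t ω : ℝ) ≤ ε * T
      · by_contra! hcon
        exact hnE ⟨t, hKt, hbt2.trans htb, htT, hna, by linarith⟩
      · refine lt_of_lt_of_le ?_ (hU T t (fun b => pulls A b t ω) (fun b => empMean A X b t ω) a
          hpt (pulls_le a t ω) htT.le).1
        have hβε : β * T ≤ ε * T := by gcongr; exact min_le_right _ _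
        have h1 := (abs_lt.mp (hline a t htT.le (hβε.trans (not_le.mp hna).le) (hpt a))).1
        simp only [empMean_eq a (m a) t ω (hpt a)]
        linarith
    linarith [hm b hba]
  calc _ ≤ P (E ∪ ⋃ b, S b) := measure_mono hsub
    _ ≤ P E + ∑ b, P (S b) :=
      (measure_union_le _ _).trans (add_le_add le_rfl (measure_iUnion_fintype_le _ _))
    _ ≤ ENNReal.ofReal (1 / 4) + ∑ _b : Fin K, ENNReal.ofReal (1 / (4 * K)) :=
      add_le_add hE (Finset.sum_le_sum fun b _ => hS b)
    _ = ENNReal.ofReal (1 / 2) := by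
      rw [← ENNReal.ofReal_sum_of_nonneg (fun _ _ => by positivity),
        ← ENNReal.ofReal_add (by norm_num) (Finset.sum_nonneg fun _ _ => by positivity)]
      congr 1
      simp only [Finset.sum_const, Finset.card_univ, Fintype.card_fin, nsmul_eq_mul]
      field_simp
      norm_num

/-! ### Tilting a sub-Gaussian law -/

section

variable {ν : Measure ℝ} {μ : ℝ}

/-- A bounded score function of mean zero that favours the rewards above `μ`. -/
noncomputable def score (ν : Measure ℝ) (μ : ℝ) (x : ℝ) : ℝ :=
  (Set.Ioi μ).indicator 1 x - ν.real (Set.Ioi μ)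

theorem measurable_score : Measurable (score ν μ) :=
  (measurable_one.indicator measurableSet_Ioi).sub_const _

/-- The density of the law tilted by `θ` times the score. -/
noncomputable def tilt (ν : Measure ℝ) (μ θ : ℝ) (x : ℝ) : ℝ≥0∞ :=
  ENNReal.ofReal (1 + θ * score ν μ x)

theorem measurable_tilt (θ : ℝ) : Measurable (tilt ν μ θ) :=
  ((measurable_score.const_mul θ).const_add 1).ennreal_ofReal

variable [IsProbabilityMeasure ν]

/-- Reweighting a sub-Gaussian law by a bounded density keeps it sub-Gaussian. -/
theorem isSubgaussianAt_withDensity (hs : HasSubgaussianMGF (fun x : ℝ => x - μ) 1 ν) {w : ℝ → ℝ}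
    (hw : Measurable w) (hw0 : ∀ x, 0 ≤ w x) (hw1 : ∀ x, w x ≤ 3 / 2) (hwi : ∫ x, w x ∂ν = 1) :
    IsSubgaussianAt (ν.withDensity fun x => ENNReal.ofReal (w x))
      (μ + ∫ x, (x - μ) * w x ∂ν) 3 := by
  intro l
  set d := ∫ x, (x - μ) * w x ∂ν with hd
  have hint : ∀ f : ℝ → ℝ, Integrable f ν → Integrable (fun x => f x * w x) ν := fun f hf =>
    hf.mul_bdd (c := 3 / 2) hw.aestronglyMeasurable
      (ae_of_all _ fun x => by rw [Real.norm_of_nonneg (hw0 x)]; exact hw1 x)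
  have hwint : Integrable w ν := by simpa using hint (fun _ => 1) (integrable_const 1)
  have hexp := hs.integrable_exp_mul
  have hcenter : ∀ x : ℝ, Real.exp (l * (x - (μ + d))) =
      Real.exp (-(l * d)) * Real.exp (l * (x - μ)) := fun x => by
    rw [← Real.exp_add]; ring_nf
  set a := ∫ x, Real.exp (l * (x - μ)) * w x ∂ν with ha
  set b := ∫ x, Real.exp (-l * (x - μ)) * w x ∂ν with hb
  have ha0 : 0 ≤ a := integral_nonneg fun x => mul_nonneg (Real.exp_nonneg _) (hw0 x)
  -- Jensen's inequality in tangent-line form bounds the centring factor by the opposite exponential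
  -- moment `b`. Bounding `w` by 3/2 directly would leave a prefactor that spoils sub-Gaussianity
  -- near `l = 0`.
  have hlow : Real.exp (-(l * d)) ≤ b := by
    have h1 : ∫ x, (1 + l * d - l * (x - μ)) * w x ∂ν = 1 := by
      have : ∀ x, (1 + l * d - l * (x - μ)) * w x = (1 + l * d) * w x - l * ((x - μ) * w x) :=
        fun x => by ring
      simp_rw [this]
      rw [integral_sub (hwint.const_mul _) ((hint _ hs.integrable).const_mul _),
        integral_const_mul, integral_const_mul, hwi, ← hd]
      ring
    have h2 : 1 ≤ ∫ x, Real.exp (l * d) * (Real.exp (-l * (x - μ)) * w x) ∂ν := by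
      rw [← h1]
      refine integral_mono (hint _ ((integrable_const _).sub (hs.integrable.const_mul l)))
        ((hint _ (hexp (-l))).const_mul _) fun x => ?_
      have := Real.add_one_le_exp (l * d - l * (x - μ))
      calc (1 + l * d - l * (x - μ)) * w x ≤ Real.exp (l * d - l * (x - μ)) * w x := by
            gcongr
            · exact hw0 x
            · linarith
        _ = _ := by rw [← mul_assoc, ← Real.exp_add]; ring_nf
    rw [integral_const_mul] at h2
    rw [Real.exp_neg, inv_le_iff_one_le_mul₀' (Real.exp_pos _)]
    exact h2
  -- Symmetrizing produces `cosh ≥ 1`, so `w ≤ 3/2` is applied only to `cosh - 1`; Bernoulli's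
  -- inequality with exponent 3/2 then absorbs the constant.
  have hup : (a + b) / 2 ≤ Real.exp (3 * l ^ 2 / 4) := by
    have hc : Integrable (fun x => (Real.exp (l * (x - μ)) + Real.exp (-l * (x - μ))) / 2) ν :=
      ((hexp l).add (hexp (-l))).div_const 2
    have hc1 : Integrable (fun x => (Real.exp (l * (x - μ)) + Real.exp (-l * (x - μ))) / 2 - 1) ν :=
      hc.sub (integrable_const 1)
    have h1 : (a + b) / 2 = ∫ x, (Real.exp (l * (x - μ)) + Real.exp (-l * (x - μ))) / 2 * w x ∂ν := by
      rw [ha, hb, ← integral_add (hint _ (hexp l)) (hint _ (hexp (-l))), ← integral_div]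
      exact integral_congr_ae (ae_of_all _ fun x => by ring)
    have h2 : ∀ x, (Real.exp (l * (x - μ)) + Real.exp (-l * (x - μ))) / 2 * w x ≤
        w x + 3 / 2 * ((Real.exp (l * (x - μ)) + Real.exp (-l * (x - μ))) / 2 - 1) := fun x => by
      have := Real.one_le_cosh (l * (x - μ))
      rw [Real.cosh_eq, ← neg_mul] at this
      nlinarith [hw0 x, hw1 x]
    have h3 : ∫ x, (w x + 3 / 2 * ((Real.exp (l * (x - μ)) +
        Real.exp (-l * (x - μ))) / 2 - 1)) ∂ν ≤ 1 + 3 / 2 * (Real.exp (l ^ 2 / 2) - 1) := by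
      rw [integral_add hwint (hc1.const_mul _), hwi, integral_const_mul,
        integral_sub hc (integrable_const 1), integral_div, integral_add (hexp l) (hexp (-l))]
      have h4 := hs.mgf_le l
      have h5 := hs.mgf_le (-l)
      simp only [mgf, NNReal.coe_one, one_mul, neg_sq] at h4 h5
      simp only [integral_const, probReal_univ, smul_eq_mul, mul_one]
      linarith
    have h4 : 1 + 3 / 2 * (Real.exp (l ^ 2 / 2) - 1) ≤ Real.exp (3 * l ^ 2 / 4) := by
      have h5 := Real.add_one_le_exp (l ^ 2 / 2)
      have := one_add_mul_self_le_rpow_one_add (s := Real.exp (l ^ 2 / 2) - 1)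
        (by nlinarith [sq_nonneg l]) (p := 3 / 2) (by norm_num)
      refine this.trans (le_of_eq ?_)
      rw [add_sub_cancel, ← Real.exp_mul]
      ring_nf
    rw [h1]
    exact (integral_mono (hint _ hc) (hwint.add (hc1.const_mul _)) h2).trans
      (h3.trans h4)
  -- By AM-GM, `a b` is at most `((a + b) / 2)²`, whence the variance proxy 3.
  have hmain : Real.exp (-(l * d)) * a ≤ Real.exp (3 * l ^ 2 / 2) := by
    have hb0 : 0 ≤ b := (Real.exp_nonneg _).trans hlow
    calc Real.exp (-(l * d)) * a ≤ b * a := by gcongr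
      _ ≤ ((a + b) / 2) ^ 2 := by nlinarith [sq_nonneg (a - b)]
      _ ≤ Real.exp (3 * l ^ 2 / 4) ^ 2 := by gcongr
      _ = _ := by rw [← Real.exp_nat_mul]; ring_nf
  rw [lintegral_withDensity_eq_lintegral_mul _ (by fun_prop) (by fun_prop)]
  have hfun : ∀ x, ((fun x => ENNReal.ofReal (w x)) * fun x =>
      ENNReal.ofReal (Real.exp (l * (x - (μ + d))))) x =
      ENNReal.ofReal (Real.exp (-(l * d)) * (Real.exp (l * (x - μ)) * w x)) := fun x => by
    rw [Pi.mul_apply, ← ENNReal.ofReal_mul (hw0 x), hcenter]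
    ring_nf
  simp_rw [hfun]
  rw [← ofReal_integral_eq_lintegral_ofReal ((hint _ (hexp l)).const_mul _)
    (ae_of_all _ fun x => mul_nonneg (Real.exp_nonneg _) (mul_nonneg (Real.exp_nonneg _) (hw0 x))),
    integral_const_mul]
  exact ENNReal.ofReal_le_ofReal hmain

theorem abs_score_le (x : ℝ) : |score ν μ x| ≤ 1 := by
  have h0 : 0 ≤ ν.real (Set.Ioi μ) := measureReal_nonneg
  have h1 : ν.real (Set.Ioi μ) ≤ 1 := measureReal_le_one
  unfold score
  rw [abs_le]
  by_cases h : x ∈ Set.Ioi μ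
  · simp only [Set.indicator_of_mem h, Pi.one_apply]; constructor <;> linarith
  · simp only [Set.indicator_of_notMem h]; constructor <;> linarith

theorem integrable_score : Integrable (score ν μ) ν :=
  Integrable.of_bound measurable_score.aestronglyMeasurable 1 (ae_of_all _ abs_score_le)

theorem integral_score : ∫ x, score ν μ x ∂ν = 0 := by
  unfold score
  have h : Integrable ((Set.Ioi μ).indicator (1 : ℝ → ℝ)) ν :=
    (integrable_const 1).indicator measurableSet_Ioi
  rw [integral_sub h (integrable_const _), integral_indicator_one measurableSet_Ioi]
  simp

/-- Up to a multiple of `x - μ`, which integrates to zero, the integrand is `|x - μ| / 2`; positive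
variance makes the mean absolute deviation positive. So tilting by `θ` raises the mean to first
order in `θ`. -/
theorem integral_mul_score_pos (hs : HasSubgaussianMGF (fun x : ℝ => x - ∫ y, y ∂ν) 1 ν)
    (hvar : 0 < variance (fun x : ℝ => x) ν) :
    0 < ∫ x, (x - ∫ y, y ∂ν) * score ν (∫ y, y ∂ν) x ∂ν := by
  set μ := ∫ y, y ∂ν with hμ
  have hint : Integrable (fun x : ℝ => x - μ) ν := hs.integrable
  have hid : Integrable (fun x : ℝ => x) ν :=
    (hint.add (integrable_const μ)).congr (ae_of_all _ fun x => by simp)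
  have h0 : ∫ x, (x - μ) ∂ν = 0 := by
    rw [integral_sub hid (integrable_const μ)]; simp [hμ]
  have hpt : ∀ x, (x - μ) * score ν μ x =
      |x - μ| / 2 + (1 / 2 - ν.real (Set.Ioi μ)) * (x - μ) := fun x => by
    unfold score
    by_cases h : x ∈ Set.Ioi μ
    · rw [Set.indicator_of_mem h, abs_of_pos (sub_pos.mpr h), Pi.one_apply]; ring
    · have h' : x ≤ μ := not_lt.mp h
      rw [Set.indicator_of_notMem h, abs_of_nonpos (sub_nonpos.mpr h')]; ring
  simp_rw [hpt]
  rw [integral_add (hint.abs.div_const 2) (hint.const_mul _), integral_const_mul, h0, mul_zero,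
    add_zero, integral_div]
  have hnn : 0 ≤ ∫ x, |x - μ| ∂ν := integral_nonneg fun x => abs_nonneg _
  refine half_pos (hnn.lt_of_ne fun h => ?_)
  have h1 := (integral_eq_zero_iff_of_nonneg (fun x => abs_nonneg (x - μ)) hint.abs).mp h.symm
  have h2 : (fun x : ℝ => x) =ᵐ[ν] fun _ => μ := by
    filter_upwards [h1] with x hx
    have : x - μ = 0 := by simpa using hx
    linarith
  rw [variance_congr h2, variance_eq_integral aemeasurable_const] at hvar
  simp at hvar

theorem tilt_bounds {θ : ℝ} (h0 : 0 ≤ θ) (h1 : θ ≤ 1 / 2) (x : ℝ) :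
    0 ≤ 1 + θ * score ν μ x ∧ 1 + θ * score ν μ x ≤ 3 / 2 := by
  have := abs_le.mp (abs_score_le (ν := ν) (μ := μ) x)
  constructor <;> nlinarith

theorem integral_one_add_mul_score (θ : ℝ) : ∫ x, (1 + θ * score ν μ x) ∂ν = 1 := by
  rw [integral_add (integrable_const 1) (integrable_score.const_mul θ), integral_const_mul,
    integral_score]
  simp

theorem lintegral_tilt {θ : ℝ} (h0 : 0 ≤ θ) (h1 : θ ≤ 1 / 2) : ∫⁻ x, tilt ν μ θ x ∂ν = 1 := by
  have hi : Integrable (fun x => 1 + θ * score ν μ x) ν :=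
    (integrable_const 1).add (integrable_score.const_mul θ)
  unfold tilt
  rw [← ofReal_integral_eq_lintegral_ofReal hi
    (ae_of_all _ fun x => (tilt_bounds h0 h1 x).1), integral_one_add_mul_score, ENNReal.ofReal_one]

/-- The linear term vanishes because the score has mean zero, so the cost of the tilt is of second
order in `θ`. -/
theorem lintegral_tilt_sq_le {θ : ℝ} (h0 : 0 ≤ θ) (h1 : θ ≤ 1 / 2) :
    ∫⁻ x, tilt ν μ θ x ^ 2 ∂ν ≤ ENNReal.ofReal (1 + θ ^ 2) := by
  have hpt : ∀ x, tilt ν μ θ x ^ 2 ≤ ENNReal.ofReal ((1 + θ ^ 2) + 2 * θ * score ν μ x) := by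
    intro x
    unfold tilt
    rw [← ENNReal.ofReal_pow (tilt_bounds h0 h1 x).1]
    refine ENNReal.ofReal_le_ofReal ?_
    have h2 : score ν μ x ^ 2 ≤ 1 := (sq_le_one_iff_abs_le_one _).mpr (abs_score_le x)
    nlinarith [mul_le_mul_of_nonneg_left h2 (sq_nonneg θ)]
  have hi : Integrable (fun x => (1 + θ ^ 2) + 2 * θ * score ν μ x) ν :=
    (integrable_const _).add (integrable_score.const_mul _)
  refine (lintegral_mono hpt).trans ?_
  rw [← ofReal_integral_eq_lintegral_ofReal hi (ae_of_all _ fun x => ?_),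
    integral_add (integrable_const _) (integrable_score.const_mul _), integral_const_mul,
    integral_score]
  · simp
  · have := abs_le.mp (abs_score_le (ν := ν) (μ := μ) x)
    simp only [Pi.zero_apply]
    nlinarith [sq_nonneg θ]

theorem isSubgaussianAt_tilt (hs : HasSubgaussianMGF (fun x : ℝ => x - ∫ y, y ∂ν) 1 ν) {θ : ℝ}
    (h0 : 0 ≤ θ) (h1 : θ ≤ 1 / 2) :
    IsSubgaussianAt (ν.withDensity (tilt ν (∫ y, y ∂ν) θ))
      ((∫ y, y ∂ν) + θ * ∫ x, (x - ∫ y, y ∂ν) * score ν (∫ y, y ∂ν) x ∂ν) 3 := by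
  set μ := ∫ y, y ∂ν with hμ
  have hint : Integrable (fun x : ℝ => x - μ) ν := hs.integrable
  have hid : Integrable (fun x : ℝ => x) ν :=
    (hint.add (integrable_const μ)).congr (ae_of_all _ fun x => by simp)
  have h2 := isSubgaussianAt_withDensity hs ((measurable_score (ν := ν) (μ := μ)).const_mul θ
    |>.const_add 1) (fun x => (tilt_bounds h0 h1 x).1) (fun x => (tilt_bounds h0 h1 x).2)
    (integral_one_add_mul_score θ)
  have h3 : ∫ x, (x - μ) * (1 + θ * score ν μ x) ∂ν = θ * ∫ x, (x - μ) * score ν μ x ∂ν := by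
    have hpt : ∀ x, (x - μ) * (1 + θ * score ν μ x) = (x - μ) + θ * ((x - μ) * score ν μ x) :=
      fun x => by ring
    simp_rw [hpt]
    rw [integral_add hint ((hint.mul_bdd (c := 1) measurable_score.aestronglyMeasurable
      (ae_of_all _ abs_score_le)).const_mul θ), integral_const_mul,
      integral_sub hid (integrable_const μ)]
    simp [hμ]
  rw [h3] at h2
  exact h2

end

/-! ### Instability -/

/-- On a bandit with identical arms, each arm has a chance bounded away from zero to be pulled in
most rounds. -/
theorem exists_pos_le_measure_pulls {K : ℕ} (hK : 0 < K) {ν : Measure ℝ} [IsProbabilityMeasure ν]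
    (hsub : HasSubgaussianMGF (fun x : ℝ => x - ∫ y, y ∂ν) 1 ν)
    (hvar : 0 < variance (fun x : ℝ => x) ν) {U : Index K} {c : ℝ} (hc : 0 < c)
    (hU : HasLogBonus U c) (hp : IsPersistent.{u} U 3) :
    ∃ q : ℝ≥0∞, 0 < q ∧ ∃ T₀ : ℕ, ∀ (Ω : Type u) [MeasurableSpace Ω] (P : Measure Ω)
      [IsProbabilityMeasure P] (T : ℕ) (A : ℕ → Ω → Fin K) (X : ℕ → Ω → ℝ) (a : Fin K), T₀ ≤ T →
      IsAdaptive P (fun _ => ν) T A X → FollowsIndex U T A X →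
      q ≤ P {ω | 9 / 10 * (T : ℝ) ≤ pulls A a T ω} := by
  obtain ⟨D, T₁, hD⟩ := exists_measure_pulls_lt_le_half hK hc (by norm_num : (0 : ℝ) < 3) hU hp
  set μ := ∫ y, y ∂ν with hμ
  set v := ∫ x, (x - μ) * score ν μ x ∂ν with hv_def
  have hv : 0 < v := integral_mul_score_pos hsub hvar
  -- With `θ = h / √T` the gap `Δ = θ v` satisfies `Δ² T = (√|D| + 1)² ≥ D`.
  set h : ℝ := (√|D| + 1) / v with hh_def
  have hh : 0 < h := by positivity
  have hhv : h * v = √|D| + 1 := by rw [hh_def]; field_simp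
  -- The second moment of the likelihood ratio is at most `exp (h²) = M / 4`, so truncation at `M`
  -- loses at most 1/4 of the probability 1/2.
  set M : ℝ := 4 * Real.exp (h ^ 2) with hM_def
  have hM : 0 < M := by positivity
  refine ⟨ENNReal.ofReal (1 / (4 * M)), by simpa using hM, max T₁ (⌈4 * h ^ 2⌉₊ + 1),
    fun Ω _ P _ T A X a hT hA hF => ?_⟩
  have hT1 : T₁ ≤ T := (le_max_left _ _).trans hT
  have hT2n : ⌈4 * h ^ 2⌉₊ + 1 ≤ T := (le_max_right _ _).trans hT
  have hT2 : 4 * h ^ 2 ≤ (T : ℝ) := (Nat.le_ceil _).trans (by exact_mod_cast (by omega))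
  have hT0n : 0 < T := by omega
  have hT0 : (0 : ℝ) < T := by exact_mod_cast hT0n
  have hsT : 0 < √(T : ℝ) := Real.sqrt_pos.mpr hT0
  have hsT2 : √(T : ℝ) ^ 2 = T := Real.sq_sqrt hT0.le
  set θ : ℝ := h / √T with hθ_def
  have hθ0 : 0 < θ := by positivity
  have hθ2 : θ ^ 2 * T = h ^ 2 := by rw [hθ_def, div_pow, hsT2]; field_simp
  have hθ1 : θ ≤ 1 / 2 := by
    rw [hθ_def, div_le_iff₀ hsT]
    have := Real.le_sqrt_of_sq_le (show (2 * h) ^ 2 ≤ (T : ℝ) by linarith)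
    linarith
  set θ' : Fin K → ℝ := fun b => if b = a then θ else 0 with hθ'_def
  have hθ'0 : ∀ b, 0 ≤ θ' b := fun b => by simp only [hθ'_def]; split_ifs <;> linarith
  have hθ'1 : ∀ b, θ' b ≤ 1 / 2 := fun b => by simp only [hθ'_def]; split_ifs <;> linarith
  have hθ'2 : ∀ b, θ' b ≤ θ := fun b => by simp only [hθ'_def]; split_ifs <;> linarith
  set G : Fin K → ℝ → ℝ≥0∞ := fun b => tilt ν μ (θ' b) with hG_def
  have hG : ∀ b, Measurable (G b) := fun b => measurable_tilt _
  have hG1 : ∀ b, ∫⁻ x, G b x ∂ν = 1 := fun b => lintegral_tilt (hθ'0 b) (hθ'1 b)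
  have hG2 : ∀ b, ∫⁻ x, G b x ^ 2 ∂ν ≤ ENNReal.ofReal (1 + θ ^ 2) := fun b =>
    (lintegral_tilt_sq_le (hθ'0 b) (hθ'1 b)).trans
      (ENNReal.ofReal_le_ofReal (by have := pow_le_pow_left₀ (hθ'0 b) (hθ'2 b) 2; linarith))
  have hQp := hA.isProbabilityMeasure_withDensity hG hG1
  have hνp : ∀ b, IsProbabilityMeasure (ν.withDensity (G b)) := fun b =>
    ⟨by rw [withDensity_apply _ MeasurableSet.univ, Measure.restrict_univ, hG1]⟩
  set Q := P.withDensity (likelihood G A X T) with hQ_def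
  -- Following the index is a pathwise property, so `hF` holds unchanged under `Q`.
  have hQ := hD Ω Q (fun b => ν.withDensity (G b)) T A X (fun b => μ + θ' b * v) a (θ * v) hT1
    (hA.withDensity hG hG1) hF (fun b => isSubgaussianAt_tilt hsub (hθ'0 b) (hθ'1 b))
    (by positivity) (by
      rw [mul_pow, mul_right_comm, hθ2, ← mul_pow, hhv]
      have h1 := Real.sq_sqrt (abs_nonneg D)
      have h2 := le_abs_self D
      nlinarith [Real.sqrt_nonneg |D|])
    (fun b hb => by simp [hθ'_def, hb])
  set S : Set Ω := {ω | 9 / 10 * (T : ℝ) ≤ pulls A a T ω} with hS_def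
  have hcompl : Sᶜ = {ω | (pulls A a T ω : ℝ) < 9 / 10 * T} := by
    ext ω; simp [hS_def]
  have hQS : ENNReal.ofReal (1 / 2) ≤ Q S := by
    have h1 : (1 : ℝ≥0∞) ≤ Q S + ENNReal.ofReal (1 / 2) := by
      calc (1 : ℝ≥0∞) = Q Set.univ := measure_univ.symm
        _ ≤ Q S + Q Sᶜ := by rw [← Set.union_compl_self S]; exact measure_union_le _ _
        _ ≤ _ := by rw [hcompl]; gcongr
    have h2 : (1 : ℝ≥0∞) = ENNReal.ofReal (1 / 2) + ENNReal.ofReal (1 / 2) := by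
      rw [← ENNReal.ofReal_add (by norm_num) (by norm_num)]; norm_num
    rw [h2] at h1
    exact (ENNReal.add_le_add_iff_right ENNReal.ofReal_ne_top).mp h1
  have hle := hQS.trans (hA.le_measure_of_withDensity hG (r := ENNReal.ofReal (1 + θ ^ 2))
    (by simp; positivity) ENNReal.ofReal_ne_top hG2 (M := ENNReal.ofReal M) (by simpa using hM)
    ENNReal.ofReal_ne_top S)
  have hpow : ENNReal.ofReal (1 + θ ^ 2) ^ T / ENNReal.ofReal M ≤ ENNReal.ofReal (1 / 4) := by
    rw [← ENNReal.ofReal_pow (by positivity), ← ENNReal.ofReal_div_of_pos hM]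
    refine ENNReal.ofReal_le_ofReal ?_
    rw [div_le_iff₀ hM, hM_def]
    calc (1 + θ ^ 2) ^ T ≤ Real.exp (θ ^ 2) ^ T := by
          gcongr
          linarith [Real.add_one_le_exp (θ ^ 2)]
      _ = Real.exp (h ^ 2) := by rw [← Real.exp_nat_mul, mul_comm, hθ2]
      _ = _ := by ring
  have hfin : P S ≠ ∞ := measure_ne_top _ _
  rw [← ENNReal.ofReal_toReal hfin] at hle ⊢
  have hle2 := hle.trans (add_le_add_right hpow _)
  rw [← ENNReal.ofReal_mul hM.le, ← ENNReal.ofReal_add (by positivity) (by norm_num),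
    ENNReal.ofReal_le_ofReal_iff (by positivity)] at hle2
  refine ENNReal.ofReal_le_ofReal ?_
  rw [div_le_iff₀ (by positivity)]
  linarith

theorem isUnstable_of_hasLogBonus {K : ℕ} (hK : 2 ≤ K) {ν : Measure ℝ} [IsProbabilityMeasure ν]
    (hsub : HasSubgaussianMGF (fun x : ℝ => x - ∫ y, y ∂ν) 1 ν)
    (hvar : 0 < variance (fun x : ℝ => x) ν) {U : Index K} {c : ℝ} (hc : 0 < c)
    (hU : HasLogBonus U c) (hp : IsPersistent.{u} U 3) :
    IsUnstable.{u} (fun _ : Fin K => ν) U := by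
  intro Ω _ P _ ε A X hI hF hstable
  obtain ⟨q, hq, T₀, hT₀⟩ := exists_pos_le_measure_pulls (by omega) hsub hvar hc hU hp
  have key : ∀ T ≥ T₀, ∀ a, q ≤ P {ω | 9 / 10 * (T : ℝ) ≤ pulls (A T) a T ω} := fun T hT a =>
    hT₀ Ω P T (A T) (X T) a hT (hI T).isAdaptive (hF T)
  set a : Fin K := ⟨0, by omega⟩ with ha
  set b : Fin K := ⟨1, by omega⟩ with hb
  have hab : a ≠ b := by simp [ha, hb]
  obtain ⟨nstar, h1, h2⟩ := hstable a
  have h3 := (tendstoInMeasure_iff_dist.mp h1 (1 / 10) (by norm_num)).eventually (gt_mem_nhds hq)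
  obtain ⟨T, hT, hT1, hlt, hn⟩ := ((eventually_ge_atTop T₀).and ((eventually_ge_atTop 1).and
    (h3.and (h2.eventually (eventually_gt_atTop 0))))).exists
  have hT0 : (1 : ℝ) ≤ T := by exact_mod_cast hT1
  -- Each arm's dominance event has probability at least `q`, more than that of a ratio off by 1/10,
  -- so it contains an outcome with ratio near 1. Dominance of `a` forces `nstar T > (9/11) T`, that
  -- of `b` forces `nstar T < T / 9`.
  have hex : ∀ i, ∃ ω, 9 / 10 * (T : ℝ) ≤ pulls (A T) i T ω ∧
      |(pulls (A T) a T ω : ℝ) / nstar T - 1| < 1 / 10 := by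
    intro i
    by_contra! hcon
    refine absurd ((key T hT i).trans (measure_mono fun ω hω => ?_)) (not_le.mpr hlt)
    exact hcon ω hω
  obtain ⟨ω, hω1, hω2⟩ := hex a
  obtain ⟨ω', hω'1, hω'2⟩ := hex b
  have hsum : (pulls (A T) a T ω' : ℝ) + pulls (A T) b T ω' ≤ T := by
    have h4 := Finset.sum_le_sum_of_subset (f := fun i => pulls (A T) i T ω')
      (Finset.subset_univ {a, b})
    rw [Finset.sum_pair hab, sum_pulls] at h4
    exact_mod_cast h4
  have h5 := (abs_lt.mp hω2).2
  have h6 := (abs_lt.mp hω'2).1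
  rw [sub_lt_iff_lt_add, div_lt_iff₀ hn] at h5
  rw [lt_sub_iff_add_lt, lt_div_iff₀ hn] at h6
  linarith

/-! ### The five indices -/

theorem max_log_div_le {x y z w : ℝ} (hz : 0 < z) (hzx : z ≤ x) (hy : 0 < y) (hyx : y ≤ x)
    (hzw : z ≤ w) : max 0 (Real.log (y / w)) ≤ Real.log (x / z) := by
  refine max_le (Real.log_nonneg ((one_le_div hz).mpr hzx)) ?_
  exact Real.log_le_log (div_pos hy (hz.trans_le hzw)) (div_le_div₀ (hy.le.trans hyx) hyx hz hzw)

section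

variable {K : ℕ}

theorem moss_hasLogBonus (hK : 0 < K) : HasLogBonus (moss K) 1 := by
  intro T t n m b hpos hnt htT
  have hK1 : (1 : ℝ) ≤ K := by exact_mod_cast hK
  have hn : (0 : ℝ) < n b := by exact_mod_cast hpos b
  have hnT : (n b : ℝ) ≤ T := by exact_mod_cast hnt.trans htT
  refine ⟨le_add_of_nonneg_right (Real.sqrt_nonneg _), ?_⟩
  unfold moss
  gcongr
  rw [one_mul]
  exact max_log_div_le hn hnT (hn.trans_le hnT) le_rfl (le_mul_of_one_le_left hn.le hK1)

theorem anytimeMoss_hasLogBonus (hK : 0 < K) : HasLogBonus (anytimeMoss K) 1 := by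
  intro T t n m b hpos hnt htT
  have hK1 : (1 : ℝ) ≤ K := by exact_mod_cast hK
  have hn : (0 : ℝ) < n b := by exact_mod_cast hpos b
  have hnt' : (n b : ℝ) ≤ t := by exact_mod_cast hnt
  have htT' : (t : ℝ) ≤ T := by exact_mod_cast htT
  refine ⟨le_add_of_nonneg_right (Real.sqrt_nonneg _), ?_⟩
  unfold anytimeMoss
  gcongr
  rw [one_mul]
  exact max_log_div_le hn (hnt'.trans htT') (hn.trans_le hnt') htT'
    (le_mul_of_one_le_left hn.le hK1)

theorem vanillaMoss_hasLogBonus : HasLogBonus (vanillaMoss K) 1 := by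
  intro T t n m b _ _ _
  refine ⟨le_add_of_nonneg_right (Real.sqrt_nonneg _), ?_⟩
  simp [vanillaMoss]

/-- Since an arm has at most `t` pulls, `log(T/t)` is at most `log(T/n)`. -/
theorem ocUcb_hasLogBonus {η : ℝ} (hη : 0 < η) : HasLogBonus (ocUcb K η) (2 * (1 + η)) := by
  intro T t n m b hpos hnt htT
  have hn : (0 : ℝ) < n b := by exact_mod_cast hpos b
  have hnt' : (n b : ℝ) ≤ t := by exact_mod_cast hnt
  have htT' : (t : ℝ) ≤ T := by exact_mod_cast htT
  refine ⟨le_add_of_nonneg_right (Real.sqrt_nonneg _), ?_⟩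
  unfold ocUcb
  rw [div_mul_eq_mul_div]
  gcongr
  exact div_pos ((hn.trans_le hnt').trans_le htT') (hn.trans_le hnt')

/-- Together with `adaH_le`, this places `H_a` between `n_a` and `K n_a`, which makes ADA-UCB
comparable to MOSS. -/
theorem le_adaH {n : Fin K → ℕ} (b : Fin K) : (n b : ℝ) ≤ adaH n b := by
  unfold adaH
  calc (n b : ℝ) = min (n b : ℝ) (√((n b : ℝ) * (n b : ℝ))) := by
        rw [Real.sqrt_mul_self (by positivity), min_self]
    _ ≤ _ := Finset.single_le_sum (f := fun j => min (n b : ℝ) (√((n b : ℝ) * (n j : ℝ))))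
        (fun j _ => by positivity) (Finset.mem_univ b)

theorem adaH_le {n : Fin K → ℕ} (b : Fin K) : adaH n b ≤ K * n b := by
  unfold adaH
  calc _ ≤ ∑ _j : Fin K, (n b : ℝ) := Finset.sum_le_sum fun j _ => min_le_left _ _
    _ = _ := by simp

theorem adaUcb_hasLogBonus : HasLogBonus (adaUcb K) 2 := by
  intro T t n m b hpos hnt htT
  have hn : (0 : ℝ) < n b := by exact_mod_cast hpos b
  have hnT : (n b : ℝ) ≤ T := by exact_mod_cast hnt.trans htT
  refine ⟨le_add_of_nonneg_right (Real.sqrt_nonneg _), ?_⟩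
  unfold adaUcb
  rw [div_mul_eq_mul_div]
  gcongr
  exact max_log_div_le hn hnT (hn.trans_le hnT) le_rfl (le_adaH b)

theorem moss_isPersistent (hK : 0 < K) {C : ℝ} (hC : 0 < C) : IsPersistent.{u} (moss K) C := by
  refine isPersistent_of_log_le hC hK fun γ T t n m b hγ hγ1 hpos hnt htT hγt => ?_
  have hK0 : (0 : ℝ) < K := by exact_mod_cast hK
  have hn : (0 : ℝ) < n b := by exact_mod_cast hpos b
  have hT : (0 : ℝ) < T := hn.trans_le (by exact_mod_cast hnt.trans htT)
  unfold moss
  gcongr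
  refine le_max_of_le_right (Real.log_le_log (by positivity) ?_)
  gcongr
  exact mul_le_of_le_one_left hT.le hγ1

theorem anytimeMoss_isPersistent (hK : 0 < K) {C : ℝ} (hC : 0 < C) :
    IsPersistent.{u} (anytimeMoss K) C := by
  refine isPersistent_of_log_le hC hK fun γ T t n m b hγ hγ1 hpos hnt htT hγt => ?_
  have hK0 : (0 : ℝ) < K := by exact_mod_cast hK
  have hn : (0 : ℝ) < n b := by exact_mod_cast hpos b
  have hT : (0 : ℝ) < T := hn.trans_le (by exact_mod_cast hnt.trans htT)
  unfold anytimeMoss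
  gcongr
  exact le_max_of_le_right (Real.log_le_log (by positivity) (by gcongr))

theorem vanillaMoss_isPersistent (hK : 0 < K) {C : ℝ} (hC : 0 < C) :
    IsPersistent.{u} (vanillaMoss K) C := by
  refine isPersistent_of_log_le hC hK fun γ T t n m b hγ hγ1 hpos hnt htT hγt => ?_
  have hK1 : (1 : ℝ) ≤ K := by exact_mod_cast hK
  have hn : (0 : ℝ) < n b := by exact_mod_cast hpos b
  have hT : (0 : ℝ) < T := hn.trans_le (by exact_mod_cast hnt.trans htT)
  unfold vanillaMoss
  gcongr
  · exact mul_le_of_le_one_left hT.le hγ1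
  · exact le_mul_of_one_le_left hn.le hK1

theorem adaUcb_isPersistent (hK : 0 < K) {C : ℝ} (hC : 0 < C) : IsPersistent.{u} (adaUcb K) C := by
  refine isPersistent_of_log_le hC hK fun γ T t n m b hγ hγ1 hpos hnt htT hγt => ?_
  have hK0 : (0 : ℝ) < K := by exact_mod_cast hK
  have hn : (0 : ℝ) < n b := by exact_mod_cast hpos b
  have hT : (0 : ℝ) < T := hn.trans_le (by exact_mod_cast hnt.trans htT)
  have hH : 0 < adaH n b := hn.trans_le (le_adaH b)
  have h1 : Real.log (γ * T / (K * n b)) ≤ max 0 (Real.log (T / adaH n b)) := by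
    refine le_max_of_le_right (Real.log_le_log (by positivity) ?_)
    exact div_le_div₀ hT.le (mul_le_of_le_one_left hT.le hγ1) hH (adaH_le b)
  have h2 : 0 ≤ max 0 (Real.log (T / adaH n b)) := le_max_left _ _
  unfold adaUcb
  rw [div_mul_eq_mul_div]
  gcongr
  linarith

end

end Bandit

theorem corollary1 (K : ℕ) (hK : 2 ≤ K) (ν : Measure ℝ) [IsProbabilityMeasure ν]
    (hsub : HasSubgaussianMGF (fun x : ℝ => x - ∫ y, y ∂ν) 1 ν)
    (hvar : 0 < variance (fun x : ℝ => x) ν)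
    (η : ℝ) (hη : 0 < η) :
    Bandit.IsUnstable.{u} (fun _ : Fin K => ν) (Bandit.moss K) ∧
    Bandit.IsUnstable.{u} (fun _ : Fin K => ν) (Bandit.anytimeMoss K) ∧
    Bandit.IsUnstable.{u} (fun _ : Fin K => ν) (Bandit.vanillaMoss K) ∧
    Bandit.IsUnstable.{u} (fun _ : Fin K => ν) (Bandit.ocUcb K η) ∧
    Bandit.IsUnstable.{u} (fun _ : Fin K => ν) (Bandit.adaUcb K) := by
  have hK0 : 0 < K := by omega
  exact ⟨Bandit.isUnstable_of_hasLogBonus hK hsub hvar one_pos (Bandit.moss_hasLogBonus hK0)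
      (Bandit.moss_isPersistent hK0 three_pos),
    Bandit.isUnstable_of_hasLogBonus hK hsub hvar one_pos (Bandit.anytimeMoss_hasLogBonus hK0)
      (Bandit.anytimeMoss_isPersistent hK0 three_pos),
    Bandit.isUnstable_of_hasLogBonus hK hsub hvar one_pos Bandit.vanillaMoss_hasLogBonus
      (Bandit.vanillaMoss_isPersistent hK0 three_pos),
    Bandit.isUnstable_of_hasLogBonus hK hsub hvar (by linarith) (Bandit.ocUcb_hasLogBonus hη)
      (Bandit.ocUcb_isPersistent hK0 hη three_pos),
    Bandit.isUnstable_of_hasLogBonus hK hsub hvar two_pos Bandit.adaUcb_hasLogBonus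
      (Bandit.adaUcb_isPersistent hK0 three_pos)⟩
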